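/- Let $\Omega=\{(t_1,t_2)\in\mathbb R^2: t_2>t_1\}$, $\partial\Omega=\{(t,t):t\in\mathbb R\}$, $\overline\Omega=\Omega\cup\partial\Omega$, with the Euclidean distance $d$, and let $1\le p<\infty$. Let $\mathcal M^p$ be the set of Radon measures $\mu$ on $\Omega$ (Borel measures finite on every compact subset of $\Omega$) with $\int_\Omega d(x,\partial\Omega)^p\,d\mu(x)<\infty$. For $\mu,\nu\in\mathcal M^p$ let $\mathrm{Adm}(\mu,\nu)$ be the set of Borel measures $\rho$ on $\overline\Omega\times\overline\Omega$, finite on the compact subsets of $(\overline\Omega\times\overline\Omega)\setminus(\partial\Omega\times\partial\Omega)$, such that $\rho(A\times\overline\Omega)=\mu(A)$ and $\rho(\overline\Omega\times B)=\nu(B)$ for all Borel sets $A,B\subseteq\Omega$, and let $$\mathrm{OT}_p(\mu,\nu)=\Big(\inf_{\rho\in\mathrm{Adm}(\mu,\nu)}\iint_{\overline\Omega\times\overline\Omega}d(x,y)^p\,d\rho(x,y)\Big)^{1/p}.$$ Equip $\mathcal M^p$ with the topology of the metric $\mathrm{OT}_p$ and its Borel $\sigma$-algebra, and let $\mathcal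 W^p(\mathcal M^p)$ be the set of Borel probability measures $P$ on $\mathcal M^p$ with finite $p$-th moment, $\int\mathrm{OT}_p(\mu,0)^p\,dP(\mu)<\infty$. The linear expectation of $P\in\mathcal W^p(\mathcal M^p)$ is the unique Radon measure $\mathbb E[\boldsymbol\mu]$ on $\Omega$, $\boldsymbol\mu\sim P$, such that $$\mathbb E[\boldsymbol\mu](K)=\int_{\mathcal M^p}\mu(K)\,dP(\mu)\quad\text{for every compact }K\subset\Omega;$$ it belongs to $\mathcal M^p$. Let $P,P'\in\mathcal W^p(\mathcal M^p)$ and let $\pi$ be any coupling of $P$ and $P'$, i.e. a measure on $\mathcal M^p\times\mathcal M^p$ with marginals $P$ and $P'$. With $\boldsymbol\mu\sim P$ and $\boldsymbol\mu'\sim P'$, $$\mathrm{OT}_p^p\big(\mathbb E[\boldsymbol\mu],\mathbb E[\boldsymbol\mu']\big)\;\le\;\int_{\mathcal M^p\times\mathcal M^p}\mathrm{OT}_p^p(\mu,\mu')\,d\pi(\mu,\mu').$$ -/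

import Mathlib

open MeasureTheory Set
open scoped ENNReal

noncomputable section

namespace Persistence

/-- The Euclidean plane `ℝ²`. -/
abbrev Plane : Type := EuclideanSpace ℝ (Fin 2)

/-- The open half-plane `Ω = {(t₁, t₂) : t₂ > t₁}`. -/
def upper : Set Plane := {x | x 0 < x 1}

/-- The diagonal `∂Ω = {(t, t)}`. -/
def diag : Set Plane := {x | x 0 = x 1}

/-- The closed half-plane `Ω ∪ ∂Ω`. -/
def closedUpper : Set Plane := upper ∪ diag

/-- The Euclidean distance `d(x, ∂Ω)` to the diagonal. -/
def distDiag (x : Plane) : ℝ≥0∞ := Metric.infEDist x diag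

/-- Radon measures supported on `Ω`: Borel measures carried by `Ω` that are finite on every
compact subset of `Ω` (they may have infinite mass near the diagonal). -/
structure IsRadonOnUpper (μ : Measure Plane) : Prop where
  supported : μ upperᶜ = 0
  finite_of_isCompact : ∀ K : Set Plane, IsCompact K → K ⊆ upper → μ K < ∞

/-- The total `p`-persistence `∫_Ω d(x, ∂Ω)^p dμ(x)`. -/
def pers (p : ℝ) (μ : Measure Plane) : ℝ≥0∞ := ∫⁻ x in upper, distDiag x ^ p ∂μ

/-- The set `E_Ω`: pairs of points of the closed half-plane that are not both on the diagonal. -/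
def offDiagPairs : Set (Plane × Plane) := (closedUpper ×ˢ closedUpper) \ (diag ×ˢ diag)

/-- Admissible transport plans between `μ` and `ν`: Borel measures on the square of the closed
half-plane, finite on the compact subsets of `E_Ω`, whose marginals agree with `μ` and `ν` on `Ω`.
The mass on `∂Ω × ∂Ω` is unconstrained, and mass may be exchanged with `∂Ω` at will. -/
structure IsAdmissible (μ ν : Measure Plane) (π : Measure (Plane × Plane)) : Prop where
  supported : π (closedUpper ×ˢ closedUpper)ᶜ = 0
  finite_of_isCompact : ∀ K : Set (Plane × Plane), IsCompact K → K ⊆ offDiagPairs → π K < ∞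
  fst_marginal : ∀ A : Set Plane, MeasurableSet A → A ⊆ upper → π (A ×ˢ closedUpper) = μ A
  snd_marginal : ∀ B : Set Plane, MeasurableSet B → B ⊆ upper → π (closedUpper ×ˢ B) = ν B

/-- The cost `∬ d(x, y)^p dπ(x, y)` of a transport plan. -/
def cost (p : ℝ) (π : Measure (Plane × Plane)) : ℝ≥0∞ := ∫⁻ z, edist z.1 z.2 ^ p ∂π

/-- `OT_p(μ, ν) = (inf over admissible plans of the cost)^(1/p)`, for arbitrary measures. -/
def OTMeasure (p : ℝ) (μ ν : Measure Plane) : ℝ≥0∞ :=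
  (⨅ (π : Measure (Plane × Plane)) (_ : IsAdmissible μ ν π), cost p π) ^ (1 / p)

/-- The space `𝓜^p` of Radon measures supported on `Ω` with finite `p`-persistence. -/
def PersMeasure (p : ℝ) : Type := {μ : Measure Plane // IsRadonOnUpper μ ∧ pers p μ < ∞}

namespace PersMeasure

variable {p : ℝ}

/-- The underlying Borel measure of an element of `𝓜^p`. -/
def toMeasure (μ : PersMeasure p) : Measure Plane := μ.1

/-- The zero measure (the empty diagram). -/
instance : Zero (PersMeasure p) :=
  ⟨⟨0, ⟨by simp, by simp⟩, by simp [pers]⟩⟩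

/-- The distance `OT_p` on `𝓜^p`. -/
def OT (μ ν : PersMeasure p) : ℝ≥0∞ := OTMeasure p μ.toMeasure ν.toMeasure

/-- The topology of the metric `OT_p`: a set is open if and only if it contains a ball of positive
radius around each of its points. -/
instance : TopologicalSpace (PersMeasure p) where
  IsOpen s := ∀ μ ∈ s, ∃ ε : ℝ≥0∞, 0 < ε ∧ ∀ ν : PersMeasure p, OT μ ν < ε → ν ∈ s
  isOpen_univ := fun _ _ => ⟨1, one_pos, fun _ _ => trivial⟩
  isOpen_inter := by
    rintro s t hs ht μ ⟨h1, h2⟩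
    obtain ⟨ε, hε, h⟩ := hs μ h1
    obtain ⟨δ, hδ, h'⟩ := ht μ h2
    exact ⟨min ε δ, lt_min hε hδ, fun ν hν =>
      ⟨h ν (hν.trans_le (min_le_left _ _)), h' ν (hν.trans_le (min_le_right _ _))⟩⟩
  isOpen_sUnion := by
    rintro S hS μ ⟨s, hs, hμ⟩
    obtain ⟨ε, hε, h⟩ := hS s hs μ hμ
    exact ⟨ε, hε, fun ν hν => ⟨s, hs, h ν hν⟩⟩

/-- The Borel `σ`-algebra of `(𝓜^p, OT_p)`. -/
instance : MeasurableSpace (PersMeasure p) := borel (PersMeasure p)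

instance : BorelSpace (PersMeasure p) := ⟨rfl⟩

end PersMeasure

/-- The space `𝓦^p(𝓜^p)` of Borel probability measures on `(𝓜^p, OT_p)` with finite `p`-th moment,
`∫ OT_p(μ, 0)^p dP(μ) < ∞`. -/
def Wasserstein (p : ℝ) : Type :=
  {P : Measure (PersMeasure p) // IsProbabilityMeasure P ∧ ∫⁻ μ, μ.OT 0 ^ p ∂P < ∞}

/-- The underlying measure on `𝓜^p`. -/
def Wasserstein.law {p : ℝ} (P : Wasserstein p) : Measure (PersMeasure p) := P.1

/-- Couplings of two distributions on `𝓜^p`: measures on the product with these marginals. -/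
structure IsCoupling {p : ℝ} (P P' : Wasserstein p)
    (π : Measure (PersMeasure p × PersMeasure p)) : Prop where
  map_fst : π.map Prod.fst = P.law
  map_snd : π.map Prod.snd = P'.law

/-! Basic facts that make the linear expectation a well-defined element of `𝓜^p`. -/

theorem measurableSet_upper : MeasurableSet upper := by
  unfold upper
  exact measurableSet_lt (by fun_prop) (by fun_prop)

theorem isOpen_upper : IsOpen upper := by
  unfold upper
  exact isOpen_lt (by fun_prop) (by fun_prop)

theorem isClosed_diag : IsClosed diag := by
  unfold diag
  exact isClosed_eq (by fun_prop) (by fun_prop)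

theorem continuous_distDiag : Continuous distDiag := Metric.continuous_infEDist

theorem measurable_distDiag : Measurable distDiag := continuous_distDiag.measurable

theorem distDiag_pos {x : Plane} (hx : x ∈ upper) : 0 < distDiag x := by
  unfold distDiag
  rw [Metric.infEDist_pos_iff_notMem_closure, isClosed_diag.closure_eq]
  exact ne_of_lt hx

/-- The part of `Ω` at distance more than `1 / (n + 1)` from the diagonal. -/
def layer (n : ℕ) : Set Plane := upper ∩ {x | ((n : ℝ≥0∞) + 1)⁻¹ < distDiag x}

theorem isOpen_layer (n : ℕ) : IsOpen (layer n) :=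
  isOpen_upper.inter (isOpen_lt continuous_const continuous_distDiag)

theorem monotone_layer : Monotone layer := by
  intro m n h x hx
  refine ⟨hx.1, ?_⟩
  have hx' : ((m : ℝ≥0∞) + 1)⁻¹ < distDiag x := hx.2
  change ((n : ℝ≥0∞) + 1)⁻¹ < distDiag x
  refine lt_of_le_of_lt ?_ hx'
  have h' : (m : ℝ≥0∞) ≤ n := by exact_mod_cast h
  gcongr

theorem exists_inv_lt {a : ℝ≥0∞} (ha : 0 < a) : ∃ n : ℕ, ((n : ℝ≥0∞) + 1)⁻¹ < a := by
  obtain ⟨n, hn⟩ := ENNReal.exists_inv_nat_lt ha.ne'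
  exact ⟨n, lt_of_le_of_lt (ENNReal.inv_le_inv.2 le_self_add) hn⟩

theorem iUnion_layer : ⋃ n, layer n = upper := by
  apply subset_antisymm (iUnion_subset fun n => inter_subset_left)
  intro x hx
  obtain ⟨n, hn⟩ := exists_inv_lt (distDiag_pos hx)
  exact mem_iUnion.2 ⟨n, hx, hn⟩

theorem measure_layer_lt_top {p : ℝ} (hp : 1 ≤ p) {μ : Measure Plane} (h : pers p μ < ∞) (n : ℕ) :
    μ (layer n) < ∞ := by
  have hp0 : 0 < p := by linarith
  set c : ℝ≥0∞ := (((n : ℝ≥0∞) + 1)⁻¹) ^ p with hc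
  have hc0 : c ≠ 0 := by
    rw [hc]
    simp [ENNReal.rpow_eq_zero_iff]
  have key : c * μ (layer n) ≤ pers p μ := by
    calc c * μ (layer n) = ∫⁻ _ in layer n, c ∂μ := by simp
      _ ≤ ∫⁻ x in layer n, distDiag x ^ p ∂μ := by
          apply setLIntegral_mono (measurable_distDiag.pow_const p)
          intro x hx
          exact ENNReal.rpow_le_rpow hx.2.le hp0.le
      _ ≤ pers p μ := lintegral_mono_set inter_subset_left
  by_contra hcon
  rw [not_lt_top_iff] at hcon
  rw [hcon, ENNReal.mul_top hc0] at key
  exact absurd (lt_of_le_of_lt key h) (lt_irrefl _)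

theorem isRadonOnUpper_of_pers {p : ℝ} (hp : 1 ≤ p) {μ : Measure Plane} (h0 : μ upperᶜ = 0)
    (h : pers p μ < ∞) : IsRadonOnUpper μ := by
  refine ⟨h0, fun K hK hKu => ?_⟩
  rw [← iUnion_layer] at hKu
  obtain ⟨n, hn⟩ := hK.elim_directed_cover layer isOpen_layer hKu monotone_layer.directed_le
  exact lt_of_le_of_lt (measure_mono hn) (measure_layer_lt_top hp h n)

theorem OTMeasure_rpow {p : ℝ} (hp : 1 ≤ p) (μ ν : Measure Plane) :
    OTMeasure p μ ν ^ p = ⨅ (π : Measure (Plane × Plane)) (_ : IsAdmissible μ ν π), cost p π := by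
  unfold OTMeasure
  rw [← ENNReal.rpow_mul, one_div, inv_mul_cancel₀ (by linarith), ENNReal.rpow_one]

theorem measurableSet_diag : MeasurableSet diag := isClosed_diag.measurableSet

theorem measurableSet_closedUpper : MeasurableSet closedUpper :=
  measurableSet_upper.union measurableSet_diag

theorem measurable_edist_rpow (p : ℝ) :
    Measurable fun z : Plane × Plane => edist z.1 z.2 ^ p := by fun_prop

theorem pers_le_OT_rpow {p : ℝ} (hp : 1 ≤ p) (μ : PersMeasure p) :
    pers p μ.toMeasure ≤ μ.OT 0 ^ p := by
  unfold PersMeasure.OT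
  rw [OTMeasure_rpow hp]
  refine le_iInf₂ fun π hπ => ?_
  have hmap : ((π.restrict (upper ×ˢ closedUpper)).map Prod.fst) =
      μ.toMeasure.restrict upper := by
    ext A hA
    rw [Measure.map_apply measurable_fst hA, Measure.restrict_apply (measurable_fst hA),
      Measure.restrict_apply hA, ← hπ.fst_marginal _ (hA.inter measurableSet_upper)
        inter_subset_right]
    congr 1
    ext z
    simp [and_assoc]
  have hz : ∀ᵐ z ∂π, z ∈ closedUpper ×ˢ closedUpper := hπ.supported
  have hz' : ∀ᵐ z ∂π, z ∉ closedUpper ×ˢ upper := by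
    have := hπ.snd_marginal upper measurableSet_upper subset_rfl
    have h0 : (0 : PersMeasure p).toMeasure = 0 := rfl
    rw [h0] at this
    exact measure_eq_zero_iff_ae_notMem.1 this
  unfold pers
  rw [← hmap, lintegral_map (measurable_distDiag.pow_const p) measurable_fst]
  refine le_trans (lintegral_mono_ae (g := fun z => edist z.1 z.2 ^ p) ?_)
    (setLIntegral_le_lintegral (upper ×ˢ closedUpper) _)
  apply ae_restrict_of_ae
  filter_upwards [hz, hz'] with z h1 h2
  have hd : z.2 ∈ diag := by
    rcases h1.2 with h | h
    · exact absurd ⟨h1.1, h⟩ h2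
    · exact h
  exact ENNReal.rpow_le_rpow (Metric.infEDist_le_edist_of_mem hd) (by linarith)

/-- Points of an open set `U` at distance at least `1 / (n + 1)` from the complement. -/
def innerPart (U : Set Plane) (n : ℕ) : Set Plane := {x | ((n : ℝ≥0∞) + 1)⁻¹ ≤ Metric.infEDist x Uᶜ}

theorem measurableSet_inner (U : Set Plane) (n : ℕ) : MeasurableSet (innerPart U n) :=
  (isClosed_le continuous_const Metric.continuous_infEDist).measurableSet

theorem inner_subset (U : Set Plane) (n : ℕ) : innerPart U n ⊆ U := by
  intro x hx
  by_contra h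
  have h0 : Metric.infEDist x Uᶜ = 0 := Metric.infEDist_zero_of_mem h
  have hx' : ((n : ℝ≥0∞) + 1)⁻¹ ≤ Metric.infEDist x Uᶜ := hx
  rw [h0] at hx'
  simp at hx'

theorem iUnion_inner {U : Set Plane} (hU : IsOpen U) : ⋃ n, innerPart U n = U := by
  apply subset_antisymm (iUnion_subset fun n => inner_subset U n)
  intro x hx
  have : 0 < Metric.infEDist x Uᶜ := by
    rw [Metric.infEDist_pos_iff_notMem_closure, hU.isClosed_compl.closure_eq]
    simpa using hx
  obtain ⟨n, hn⟩ := exists_inv_lt this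
  exact mem_iUnion.2 ⟨n, hn.le⟩

theorem monotone_inner (U : Set Plane) : Monotone (innerPart U) := by
  intro m n h x hx
  have h' : (m : ℝ≥0∞) ≤ n := by exact_mod_cast h
  have hx' : ((m : ℝ≥0∞) + 1)⁻¹ ≤ Metric.infEDist x Uᶜ := hx
  refine le_trans ?_ hx'
  gcongr

theorem measure_innerPart_le {p : ℝ} (hp : 1 ≤ p) (μ ν : PersMeasure p) {U : Set Plane} (hU : IsOpen U)
    (hUu : U ⊆ upper) (n : ℕ) :
    μ.toMeasure (innerPart U n) ≤
      ν.toMeasure U + μ.OT ν ^ p / (((n : ℝ≥0∞) + 1)⁻¹) ^ p := by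
  have hp0 : 0 < p := by linarith
  set c : ℝ≥0∞ := (((n : ℝ≥0∞) + 1)⁻¹) ^ p with hc
  have hc0 : c ≠ 0 := by
    rw [hc]
    simp [ENNReal.rpow_eq_zero_iff]
  have hct : c ≠ ∞ := by
    rw [hc]
    exact ENNReal.rpow_ne_top_of_nonneg hp0.le (by simp)
  have step : ∀ π, IsAdmissible μ.toMeasure ν.toMeasure π →
      c * (μ.toMeasure (innerPart U n) - ν.toMeasure U) ≤ cost p π := by
    intro π hπ
    have h1 : μ.toMeasure (innerPart U n) ≤ ν.toMeasure U + π {z | c ≤ edist z.1 z.2 ^ p} := by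
      rw [← hπ.fst_marginal _ (measurableSet_inner U n) ((inner_subset U n).trans hUu),
        ← hπ.snd_marginal _ hU.measurableSet hUu]
      refine le_trans (measure_mono ?_) (measure_union_le _ _)
      rintro ⟨x, y⟩ ⟨hx, hy⟩
      by_cases hyU : y ∈ U
      · left
        exact ⟨Or.inl (hUu (inner_subset U n hx)), hyU⟩
      · right
        have hx' : ((n : ℝ≥0∞) + 1)⁻¹ ≤ Metric.infEDist x Uᶜ := hx
        exact ENNReal.rpow_le_rpow (hx'.trans (Metric.infEDist_le_edist_of_mem hyU)) hp0.le
    calc c * (μ.toMeasure (innerPart U n) - ν.toMeasure U)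
        ≤ c * π {z | c ≤ edist z.1 z.2 ^ p} := by
          gcongr
          exact tsub_le_iff_left.2 h1
      _ ≤ cost p π := mul_meas_ge_le_lintegral (measurable_edist_rpow p) c
  have h2 : c * (μ.toMeasure (innerPart U n) - ν.toMeasure U) ≤ μ.OT ν ^ p := by
    unfold PersMeasure.OT
    rw [OTMeasure_rpow hp]
    exact le_iInf₂ step
  rw [← tsub_le_iff_left, ENNReal.le_div_iff_mul_le (Or.inl hc0) (Or.inl hct), mul_comm]
  exact h2

theorem isOpen_lt_measure {p : ℝ} (hp : 1 ≤ p) {U : Set Plane} (hU : IsOpen U) (hUu : U ⊆ upper)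
    (a : ℝ≥0∞) : IsOpen {μ : PersMeasure p | a < μ.toMeasure U} := by
  have hp0 : 0 < p := by linarith
  intro μ hμ
  have hμ' : a < μ.toMeasure U := hμ
  rw [← iUnion_inner hU, (monotone_inner U).measure_iUnion, lt_iSup_iff] at hμ'
  obtain ⟨n, hn⟩ := hμ'
  obtain ⟨b, hab, hbn⟩ := exists_between hn
  set c : ℝ≥0∞ := (((n : ℝ≥0∞) + 1)⁻¹) ^ p with hc
  have hc0 : c ≠ 0 := by
    rw [hc]
    simp [ENNReal.rpow_eq_zero_iff]
  have hct : c ≠ ∞ := by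
    rw [hc]
    exact ENNReal.rpow_ne_top_of_nonneg hp0.le (by simp)
  have hba : b - a ≠ 0 := (tsub_pos_of_lt hab).ne'
  refine ⟨((b - a) * c) ^ (1 / p), ENNReal.rpow_pos_of_nonneg (by positivity) (by positivity), ?_⟩
  intro ν hν
  by_contra hcon
  have hcon' : ν.toMeasure U ≤ a := not_lt.1 hcon
  have h1 : μ.OT ν ^ p ≤ (b - a) * c := by
    have := ENNReal.rpow_le_rpow hν.le hp0.le
    rwa [← ENNReal.rpow_mul, one_div, inv_mul_cancel₀ hp0.ne', ENNReal.rpow_one] at this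
  have h2 : μ.toMeasure (innerPart U n) ≤ a + (b - a) := by
    refine (measure_innerPart_le hp μ ν hU hUu n).trans ?_
    gcongr
    exact ENNReal.div_le_of_le_mul h1
  rw [add_tsub_cancel_of_le hab.le] at h2
  exact absurd hbn (not_lt.2 h2)

/-- Evaluations on Borel sets are Borel functions on `(𝓜^p, OT_p)`. -/
theorem measurable_toMeasure {p : ℝ} (hp : 1 ≤ p) :
    Measurable (PersMeasure.toMeasure : PersMeasure p → Measure Plane) := by
  have hopen : ∀ U : Set Plane, IsOpen U → U ⊆ upper →
      Measurable fun μ : PersMeasure p => μ.toMeasure U := fun U hU hUu =>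
    measurable_of_Ioi fun a => (isOpen_lt_measure hp hU hUu a).measurableSet
  have hlayer : ∀ n : ℕ, Measurable fun μ : PersMeasure p => μ.toMeasure.restrict (layer n) := by
    intro n
    have : ∀ μ : PersMeasure p, IsFiniteMeasure (μ.toMeasure.restrict (layer n)) := fun μ =>
      ⟨by rw [Measure.restrict_apply_univ]; exact measure_layer_lt_top hp μ.2.2 n⟩
    refine Measurable.measure_of_isPiSystem (S := {s | IsOpen s}) BorelSpace.measurable_eq
      isPiSystem_isOpen ?_ ?_
    · intro U hU
      have hU' : IsOpen U := hU
      simp only [Measure.restrict_apply hU'.measurableSet]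
      exact hopen _ (hU'.inter (isOpen_layer n)) (inter_subset_right.trans inter_subset_left)
    · simp only [Measure.restrict_apply_univ]
      exact hopen _ (isOpen_layer n) inter_subset_left
  refine Measure.measurable_of_measurable_coe _ fun A hA => ?_
  have heq : ∀ μ : PersMeasure p,
      μ.toMeasure A = ⨆ n, μ.toMeasure.restrict (layer n) A := by
    intro μ
    have h1 : μ.toMeasure A = μ.toMeasure (⋃ n, A ∩ layer n) := by
      rw [← inter_iUnion, iUnion_layer]
      exact (measure_inter_conull μ.2.1.supported).symm
    rw [h1, Monotone.measure_iUnion]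
    · simp only [Measure.restrict_apply hA]
    · exact fun m n h => inter_subset_inter_right _ (monotone_layer h)
  simp only [heq]
  exact Measurable.iSup fun n => (Measure.measurable_coe hA).comp (hlayer n)

/-- The mean measure `A ↦ ∫ μ(A) dP(μ)`. -/
def meanMeasure {p : ℝ} (P : Measure (PersMeasure p)) : Measure Plane :=
  (P.map PersMeasure.toMeasure).join

theorem meanMeasure_apply {p : ℝ} (hp : 1 ≤ p) (P : Measure (PersMeasure p)) {A : Set Plane}
    (hA : MeasurableSet A) : meanMeasure P A = ∫⁻ μ, μ.toMeasure A ∂P := by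
  unfold meanMeasure
  rw [Measure.join_apply hA, lintegral_map (Measure.measurable_coe hA) (measurable_toMeasure hp)]

theorem lintegral_meanMeasure {p : ℝ} (hp : 1 ≤ p) (P : Measure (PersMeasure p))
    {f : Plane → ℝ≥0∞} (hf : Measurable f) :
    ∫⁻ x, f x ∂(meanMeasure P) = ∫⁻ μ, ∫⁻ x, f x ∂μ.toMeasure ∂P := by
  unfold meanMeasure
  rw [Measure.lintegral_join hf.aemeasurable,
    lintegral_map (Measure.measurable_lintegral hf) (measurable_toMeasure hp)]

theorem pers_meanMeasure {p : ℝ} (hp : 1 ≤ p) (P : Measure (PersMeasure p)) :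
    pers p (meanMeasure P) = ∫⁻ μ, pers p μ.toMeasure ∂P := by
  unfold pers
  simp only [← lintegral_indicator measurableSet_upper]
  exact lintegral_meanMeasure hp P
    ((measurable_distDiag.pow_const p).indicator measurableSet_upper)

/-- The linear expectation `E[μ]`, `μ ∼ P`, of `P ∈ 𝓦^p(𝓜^p)`: the element of `𝓜^p` with
`E[μ](A) = E[μ(A)]` for every Borel set `A`. -/
def linearExpectation {p : ℝ} (hp : 1 ≤ p) (P : Wasserstein p) : PersMeasure p :=
  have hpers : pers p (meanMeasure P.law) < ∞ := by
    rw [pers_meanMeasure hp]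
    exact lt_of_le_of_lt (lintegral_mono fun μ => pers_le_OT_rpow hp μ) P.2.2
  ⟨meanMeasure P.law, isRadonOnUpper_of_pers hp (by
    rw [meanMeasure_apply hp _ measurableSet_upper.compl]
    simp [show ∀ μ : PersMeasure p, μ.toMeasure upperᶜ = 0 from fun μ => μ.2.1.supported]) hpers,
    hpers⟩

/-- The defining relation, for all Borel sets. -/
theorem linearExpectation_apply {p : ℝ} (hp : 1 ≤ p) (P : Wasserstein p) {A : Set Plane}
    (hA : MeasurableSet A) :
    (linearExpectation hp P).toMeasure A = ∫⁻ μ, μ.toMeasure A ∂P.law :=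
  meanMeasure_apply hp P.law hA

/-- A Radon measure on `Ω` is determined by its values on the compact subsets of `Ω`. -/
theorem IsRadonOnUpper.ext {μ ν : Measure Plane} (hμ : IsRadonOnUpper μ) (hν : IsRadonOnUpper ν)
    (h : ∀ K : Set Plane, IsCompact K → K ⊆ upper → μ K = ν K) : μ = ν := by
  let B : ℕ → Set Plane := fun n =>
    Metric.closedBall 0 n ∩ ({x | x 0 ≤ x 1} ∩ {x | ((n : ℝ≥0∞) + 1)⁻¹ ≤ distDiag x})
  have hBc : ∀ n, IsCompact (B n) := fun n =>
    (isCompact_closedBall 0 _).inter_right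
      ((isClosed_le (by fun_prop) (by fun_prop)).inter
        (isClosed_le continuous_const continuous_distDiag))
  have hBu : ∀ n, B n ⊆ upper := by
    rintro n x ⟨-, hx1, hx2⟩
    have hx1' : x 0 ≤ x 1 := hx1
    have hx2' : ((n : ℝ≥0∞) + 1)⁻¹ ≤ distDiag x := hx2
    refine lt_of_le_of_ne hx1' fun he => ?_
    have h0 : distDiag x = 0 := Metric.infEDist_zero_of_mem (show x ∈ diag from he)
    rw [h0] at hx2'
    simp at hx2'
  have hcover : ∀ x ∈ upper, ∃ n, x ∈ B n := by
    intro x hx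
    obtain ⟨n, hn⟩ := exists_inv_lt (distDiag_pos hx)
    obtain ⟨m, hm⟩ := exists_nat_ge ‖x‖
    have hx1 : x 0 ≤ x 1 := le_of_lt hx
    refine ⟨max n m, ?_, hx1, ?_⟩
    · rw [mem_closedBall_zero_iff]
      exact hm.trans (by exact_mod_cast le_max_right n m)
    · change _ ≤ distDiag x
      refine le_trans ?_ hn.le
      have h' : (n : ℝ≥0∞) ≤ (max n m : ℕ) := by exact_mod_cast le_max_left n m
      gcongr
  refine Measure.ext_of_generateFrom_of_cover (S := {s | IsClosed s})
    (T := insert upperᶜ (range B)) ?_ ((countable_range B).insert _) isPiSystem_isClosed ?_ ?_ ?_ ?_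
  · rw [BorelSpace.measurable_eq (α := Plane), borel_eq_generateFrom_isClosed]
  · rw [sUnion_insert, sUnion_range, eq_univ_iff_forall]
    intro x
    by_cases hx : x ∈ upper
    · exact Or.inr (mem_iUnion.2 (hcover x hx))
    · exact Or.inl hx
  · rintro t (rfl | ⟨n, rfl⟩)
    · simp [hμ.supported]
    · exact (hμ.finite_of_isCompact _ (hBc n) (hBu n)).ne
  · rintro t (rfl | ⟨n, rfl⟩) s hs
    · rw [measure_mono_null inter_subset_right hμ.supported,
        measure_mono_null inter_subset_right hν.supported]
    · exact h _ ((hBc n).inter_left hs) (inter_subset_right.trans (hBu n))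
  · rintro t (rfl | ⟨n, rfl⟩)
    · rw [hμ.supported, hν.supported]
    · exact h _ (hBc n) (hBu n)

/-- `E[μ]` is the only Radon measure on `Ω` such that `E[μ](K) = E[μ(K)]` for all compact
`K ⊆ Ω`. -/
theorem linearExpectation_unique {p : ℝ} (hp : 1 ≤ p) (P : Wasserstein p) {ν : Measure Plane}
    (hν : IsRadonOnUpper ν)
    (h : ∀ K : Set Plane, IsCompact K → K ⊆ upper → ν K = ∫⁻ μ, μ.toMeasure K ∂P.law) :
    ν = (linearExpectation hp P).toMeasure :=
  hν.ext (linearExpectation hp P).2.1 fun K hK hKu => by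
    rw [h K hK hKu, linearExpectation_apply hp P hK.measurableSet]

/-- The finite measure `μ^p = d(·, ∂Ω)^p μ`. -/
def weighted {p : ℝ} (μ : PersMeasure p) : Measure Plane :=
  μ.toMeasure.withDensity fun x => distDiag x ^ p

/-- `E[μ]^p` is the setwise mean of the finite measures `μ^p`. -/
theorem weighted_linearExpectation_apply {p : ℝ} (hp : 1 ≤ p) (P : Wasserstein p)
    {A : Set Plane} (hA : MeasurableSet A) :
    weighted (linearExpectation hp P) A = ∫⁻ μ, weighted μ A ∂P.law := by
  unfold weighted
  simp only [withDensity_apply _ hA, ← lintegral_indicator hA]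
  exact lintegral_meanMeasure hp P.law ((measurable_distDiag.pow_const p).indicator hA)

theorem weighted_apply_lt_top {p : ℝ} (μ : PersMeasure p) {A : Set Plane} (hA : MeasurableSet A) :
    weighted μ A < ∞ := by
  have h : pers p μ.toMeasure < ∞ := μ.2.2
  have h0 : μ.toMeasure (upperᶜ ∩ A) = 0 :=
    measure_mono_null inter_subset_left μ.2.1.supported
  refine lt_of_le_of_lt ?_ h
  unfold weighted pers
  rw [withDensity_apply _ hA, ← lintegral_add_compl (μ := μ.toMeasure.restrict A) _
    measurableSet_upper, Measure.restrict_restrict measurableSet_upper,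
    Measure.restrict_restrict measurableSet_upper.compl,
    setLIntegral_measure_zero (upperᶜ ∩ A) _ h0, add_zero]
  exact lintegral_mono_set inter_subset_left

/-- Agreement with the Bochner integral whenever the latter exists: let `V` be a Banach space
of (signed) measures, with continuous evaluations `ev A`, in which `μ ↦ μ^p` is represented by a
Bochner integrable function `Φ`. Then the Bochner integral of `Φ` represents `E[μ]^p`. -/
theorem ev_integral_eq_weighted_linearExpectation {p : ℝ} (hp : 1 ≤ p) (P : Wasserstein p)
    {V : Type*} [NormedAddCommGroup V] [NormedSpace ℝ V] [CompleteSpace V]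
    (ev : Set Plane → V →L[ℝ] ℝ) (Φ : PersMeasure p → V)
    (hΦ : ∀ μ A, MeasurableSet A → ev A (Φ μ) = (weighted μ A).toReal)
    (hint : Integrable Φ P.law) {A : Set Plane} (hA : MeasurableSet A) :
    ev A (∫ μ, Φ μ ∂P.law) = (weighted (linearExpectation hp P) A).toReal := by
  rw [← ContinuousLinearMap.integral_comp_comm _ hint]
  simp only [hΦ _ A hA]
  rw [weighted_linearExpectation_apply hp P hA, integral_toReal]
  · have : Measurable fun μ : PersMeasure p => weighted μ A := by
      unfold weighted
      simp only [withDensity_apply _ hA, ← lintegral_indicator hA]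
      exact (Measure.measurable_lintegral ((measurable_distDiag.pow_const p).indicator hA)).comp
        (measurable_toMeasure hp)
    exact this.aemeasurable
  · exact Filter.Eventually.of_forall fun μ => weighted_apply_lt_top μ hA

end Persistence

end

/-! If a near-optimal plan could be chosen measurably in `(μ, μ')`, its `π`-average would be a plan
between the two expectations with the required cost. The proof replaces this measurable selection by
countably many choices, at the price of errors that tend to zero.

Cut `Ω` into Whitney cells, whose diameters are small compared with their distance to the diagonal.
Two measures of finite persistence that give nearly the same masses to the cells, in the `ℓ¹` norm
weighted by the `p`-th power of that distance, are interchangeable as marginals of a plan. Mass is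
redistributed inside each cell, at a cost proportional to `θ ^ p` times the persistence, and the
excess mass of either measure goes to the diagonal, at a cost proportional to the `discrepancy`.
This is `IsPlan.exists_replace_fst`. The inequality `(a + b) ^ p ≤ A * a ^ p + B * b ^ p` with `A`
close to `1` keeps the original cost almost unchanged.

The weighted cell masses of an element of `𝓜^p` form a summable sequence, and such sequences have a
countable net. Hence `𝓜^p` splits into countably many Borel pieces on which these masses are almost
constant (`exists_partition_discrepancy_le`). On a product of two pieces, the plan of a single
well-chosen pair, scaled by the `π`-mass of the product, is corrected to have the partial means as
marginals, because the discrepancy is convex (`exists_isPlan_partialMean`). Summing over the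
products gives an admissible plan between the expectations. Then `ε` tends to `0` with `A` and `B`
fixed, and finally `A` tends to `1`.

Measurability of `OT` is never needed: its `p`-th power is only bounded below by constants on
measurable sets and split over countable measurable partitions, which `∫⁻` allows for every
function. -/

noncomputable section

namespace Persistence

/-! ### Projection onto the diagonal and a nearly sharp power inequality. -/

/-- The orthogonal projection of the plane onto the diagonal. -/
def diagProj (x : Plane) : Plane := !₂[(x 0 + x 1) / 2, (x 0 + x 1) / 2]

theorem diagProj_mem (x : Plane) : diagProj x ∈ diag := by
  simp [diag, diagProj]

theorem diagProj_of_mem {x : Plane} (hx : x ∈ diag) : diagProj x = x := by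
  have hx' : x 0 = x 1 := hx
  ext i
  fin_cases i <;> simp [diagProj, hx']

theorem measurable_diagProj : Measurable diagProj := by
  refine Continuous.measurable ?_
  unfold diagProj
  refine (PiLp.continuous_toLp 2 _).comp (continuous_pi fun i => ?_)
  fin_cases i <;> simp <;> fun_prop

theorem edist_diagProj_le (x : Plane) : edist x (diagProj x) ≤ distDiag x := by
  refine Metric.le_infEDist.2 fun y hy => ?_
  have hy' : y 0 = y 1 := hy
  rw [edist_dist, edist_dist]
  refine ENNReal.ofReal_le_ofReal ?_
  rw [EuclideanSpace.dist_eq, EuclideanSpace.dist_eq]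
  refine Real.sqrt_le_sqrt ?_
  simp only [Fin.sum_univ_two, Real.dist_eq, sq_abs, diagProj, hy']
  simp
  -- The two squared distances differ by `(x 0 + x 1 - 2 * y 1) ^ 2 / 2`.
  nlinarith [sq_nonneg (x 0 + x 1 - 2 * y 1)]

theorem notMem_upper_of_mem_diag {x : Plane} (hx : x ∈ diag) : x ∉ upper := fun h =>
  absurd (show x 0 = x 1 from hx) (ne_of_lt h)

/-- For every `A > 1` there is a finite `B` with `(a + b)^p ≤ A a^p + B b^p`. -/
theorem exists_add_rpow_le {p : ℝ} (hp : 0 < p) {A : ℝ≥0∞} (hA : 1 < A) :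
    ∃ B : ℝ≥0∞, B ≠ ∞ ∧ ∀ a b : ℝ≥0∞, (a + b) ^ p ≤ A * a ^ p + B * b ^ p := by
  obtain ⟨r, hr1, hr2⟩ : ∃ r : ℝ≥0∞, 1 < r ∧ r ^ p < A := by
    have h1 : 1 < A ^ p⁻¹ := ENNReal.one_lt_rpow hA (by positivity)
    obtain ⟨r, h, h'⟩ := exists_between h1
    refine ⟨r, h, ?_⟩
    have := ENNReal.rpow_lt_rpow h' hp
    rwa [← ENNReal.rpow_mul, inv_mul_cancel₀ hp.ne', ENNReal.rpow_one] at this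
  obtain ⟨δ, hδ0, hδ⟩ : ∃ δ : ℝ≥0∞, δ ≠ 0 ∧ 1 + δ ≤ r :=
    ⟨r - 1, (tsub_pos_of_lt hr1).ne', (add_tsub_cancel_of_le hr1.le).le⟩
  refine ⟨(δ⁻¹ + 1) ^ p, ENNReal.rpow_ne_top_of_nonneg hp.le (by simp [hδ0]), fun a b => ?_⟩
  -- If `b ≤ δ * a`, then `a + b ≤ r * a`, and `r ^ p < A`. Otherwise `a ≤ δ⁻¹ * b`, and the `b`
  -- term alone dominates.
  rcases le_total b (δ * a) with h | h
  · refine le_trans ?_ le_self_add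
    calc (a + b) ^ p ≤ (r * a) ^ p := by
          refine ENNReal.rpow_le_rpow ?_ hp.le
          calc a + b ≤ a + δ * a := by gcongr
            _ = (1 + δ) * a := by ring
            _ ≤ r * a := by gcongr
      _ = r ^ p * a ^ p := ENNReal.mul_rpow_of_nonneg _ _ hp.le
      _ ≤ A * a ^ p := by gcongr
  · refine le_trans ?_ le_add_self
    rw [← ENNReal.mul_rpow_of_nonneg _ _ hp.le]
    refine ENNReal.rpow_le_rpow ?_ hp.le
    have h1 : a ≤ δ⁻¹ * b := by
      rcases eq_or_ne δ ∞ with rfl | hδt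
      · by_cases ha : a = 0
        · simp [ha]
        · rw [ENNReal.top_mul ha, top_le_iff] at h
          have h3 : r = ∞ := by simpa using hδ
          rw [h3, ENNReal.top_rpow_of_pos hp] at hr2
          exact absurd hr2 not_top_lt
      · rw [mul_comm, ← div_eq_mul_inv, ENNReal.le_div_iff_mul_le (Or.inl hδ0) (Or.inl hδt), mul_comm]
        exact h
    calc a + b ≤ δ⁻¹ * b + b := by gcongr
      _ = (δ⁻¹ + 1) * b := by ring

/-! ### Whitney partitions of the open half-plane. -/

/-- A countable measurable partition of the open half-plane whose cells `C i` are small compared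
with their distance to the diagonal, which is of the order of `D i`. -/
structure IsWhitneyPartition (θ : ℝ≥0∞) (C : ℕ → Set Plane) (D : ℕ → ℝ≥0∞) : Prop where
  measurableSet : ∀ i, MeasurableSet (C i)
  disjoint : Pairwise (Function.onFun Disjoint C)
  iUnion_eq : ⋃ i, C i = upper
  edist_le : ∀ i, ∀ x ∈ C i, ∀ y ∈ C i, edist x y ≤ θ * D i
  distDiag_le : ∀ i, ∀ x ∈ C i, distDiag x ≤ 2 * D i
  le_distDiag : ∀ i, ∀ x ∈ C i, D i ≤ 2 * distDiag x
  ne_top : ∀ i, D i ≠ ∞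

theorem distDiag_ne_top (x : Plane) : distDiag x ≠ ∞ :=
  ne_top_of_le_ne_top (edist_ne_top x (diagProj x)) (Metric.infEDist_le_edist_of_mem (diagProj_mem x))

/-- The cells are disjointed balls around a dense sequence, with radii proportional to the distance
of the centre to the diagonal, which is `1`-Lipschitz. -/
theorem exists_isWhitneyPartition {θ : ℝ≥0∞} (hθ : 0 < θ) :
    ∃ C D, IsWhitneyPartition θ C D := by
  -- Two radii `η * D i` must add up to at most `θ * D i`, and `η ≤ 1 / 2` keeps the distance to the
  -- diagonal comparable to `D i` on the whole cell.
  set η : ℝ≥0∞ := min θ 1 / 2 with hη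
  have hη0 : 0 < η := ENNReal.half_pos (by simp [hθ.ne'])
  have hη1 : η ≤ 1 / 2 := ENNReal.div_le_div_right (min_le_right _ _) _
  have hηθ : η + η ≤ θ := by rw [hη, ENNReal.add_halves]; exact min_le_left _ _
  let y : ℕ → Plane := TopologicalSpace.denseSeq Plane
  let D : ℕ → ℝ≥0∞ := fun i => distDiag (y i)
  let U : ℕ → Set Plane := fun i => upper ∩ {x | edist x (y i) < η * D i}
  have hU : ∀ i, MeasurableSet (U i) := fun i =>
    measurableSet_upper.inter (isOpen_lt (by fun_prop) continuous_const).measurableSet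
  have hCU : ∀ i, disjointed U i ⊆ U i := fun i => disjointed_subset U i
  have htri : ∀ x z : Plane, distDiag x ≤ distDiag z + edist x z := fun x z =>
    Metric.infEDist_le_infEDist_add_edist
  have hηD : ∀ i, η * D i ≤ D i / 2 := fun i => by
    calc η * D i ≤ 1 / 2 * D i := by gcongr
      _ = D i / 2 := by rw [div_eq_mul_inv, one_mul, mul_comm, div_eq_mul_inv]
  refine ⟨disjointed U, D, fun i => MeasurableSet.disjointed hU i, disjoint_disjointed U, ?_,
    fun i x hx z hz => ?_, fun i x hx => ?_, fun i x hx => ?_, fun i => distDiag_ne_top _⟩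
  · rw [iUnion_disjointed]
    refine subset_antisymm (iUnion_subset fun i => inter_subset_left) fun x hx => ?_
    -- The centres whose ball contains `x` form an open set that contains `x` itself, so the dense
    -- sequence meets it.
    have hopen : IsOpen {z : Plane | edist x z < η * distDiag z} := by
      refine isOpen_lt (by fun_prop) ?_
      exact ENNReal.continuous_const_mul (ne_top_of_le_ne_top (by simp) hη1) |>.comp continuous_distDiag
    have hne : {z : Plane | edist x z < η * distDiag z}.Nonempty :=
      ⟨x, by simpa using ⟨hη0, distDiag_pos hx⟩⟩
    obtain ⟨i, hi⟩ := (TopologicalSpace.denseRange_denseSeq Plane).exists_mem_open hopen hne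
    exact mem_iUnion.2 ⟨i, hx, hi⟩
  · calc edist x z ≤ edist x (y i) + edist z (y i) := edist_triangle_right _ _ _
      _ ≤ η * D i + η * D i := add_le_add (hCU i hx).2.le (hCU i hz).2.le
      _ = (η + η) * D i := by ring
      _ ≤ θ * D i := by gcongr
  · calc distDiag x ≤ D i + edist x (y i) := htri _ _
      _ ≤ D i + D i := by
        gcongr
        exact (hCU i hx).2.le.trans ((hηD i).trans ENNReal.half_le_self)
      _ = 2 * D i := by ring
  · have h1 : D i ≤ distDiag x + D i / 2 := by
      refine (htri (y i) x).trans ?_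
      gcongr
      rw [edist_comm]
      exact (hCU i hx).2.le.trans (hηD i)
    have hDt : D i / 2 ≠ ∞ := ENNReal.div_ne_top (distDiag_ne_top _) (by simp)
    have h2 : D i / 2 ≤ distDiag x := by
      nth_rewrite 1 [← ENNReal.add_halves (D i)] at h1
      exact (ENNReal.add_le_add_iff_right hDt).1 h1
    calc D i = D i / 2 + D i / 2 := (ENNReal.add_halves _).symm
      _ ≤ distDiag x + distDiag x := add_le_add h2 h2
      _ = 2 * distDiag x := by ring

namespace IsWhitneyPartition

variable {θ : ℝ≥0∞} {C : ℕ → Set Plane} {D : ℕ → ℝ≥0∞}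

theorem subset_upper (h : IsWhitneyPartition θ C D) (i : ℕ) : C i ⊆ upper := h.iUnion_eq ▸ subset_iUnion C i

/-- The cell masses, weighted with the distances of the cells to the diagonal, are controlled by
the total persistence. -/
theorem tsum_le_pers (h : IsWhitneyPartition θ C D) {p : ℝ} (hp : 0 ≤ p) (M : Measure Plane) :
    ∑' i, M (C i) * D i ^ p ≤ 2 ^ p * pers p M := by
  unfold pers
  rw [← h.iUnion_eq, lintegral_iUnion h.measurableSet h.disjoint, ← ENNReal.tsum_mul_left]
  refine ENNReal.tsum_le_tsum fun i => ?_
  rw [← lintegral_const_mul _ (measurable_distDiag.pow_const p), mul_comm,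
    ← setLIntegral_const]
  refine setLIntegral_mono' (h.measurableSet i) fun x hx => ?_
  rw [← ENNReal.mul_rpow_of_nonneg _ _ hp]
  exact ENNReal.rpow_le_rpow (h.le_distDiag i x hx) hp

theorem measure_lt_top (h : IsWhitneyPartition θ C D) {p : ℝ} (hp : 0 ≤ p) {M : Measure Plane} (hM : pers p M < ∞) (i : ℕ) :
    M (C i) < ∞ := by
  rcases (C i).eq_empty_or_nonempty with he | ⟨x, hx⟩
  · simp [he]
  have hD : D i ≠ 0 := by
    intro h0
    have := h.distDiag_le i x hx
    rw [h0, mul_zero, nonpos_iff_eq_zero] at this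
    exact (distDiag_pos (h.subset_upper i hx)).ne' this
  have h1 : M (C i) * D i ^ p < ∞ :=
    ((ENNReal.le_tsum i).trans (h.tsum_le_pers hp M)).trans_lt
      (ENNReal.mul_lt_top (ENNReal.rpow_lt_top_of_nonneg hp (by simp)) hM)
  by_contra hcon
  rw [not_lt_top_iff] at hcon
  rw [hcon, ENNReal.top_mul] at h1
  · exact lt_irrefl _ h1
  · simp [ENNReal.rpow_eq_zero_iff, hD, h.ne_top i]

end IsWhitneyPartition

/-- The witness is `(max a b)⁻¹`. With `a` and `b` the masses that two measures give to a cell, `c *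
a * b` is the mass that can stay in the cell, and `1 - c * a`, `1 - c * b` are the fractions that
have to leave. -/
theorem exists_mul_mul_eq_min {a b : ℝ≥0∞} (ha : a ≠ ∞) (hb : b ≠ ∞) :
    ∃ c : ℝ≥0∞, c * a ≤ 1 ∧ c * b ≤ 1 ∧ c * a * b = min a b := by
  rcases eq_or_ne (max a b) 0 with h | h
  · have h' : a = 0 ∧ b = 0 := by simpa using h
    exact ⟨0, by simp [h'.1, h'.2]⟩
  · have ht : max a b ≠ ∞ := by simp [ha, hb]
    refine ⟨(max a b)⁻¹, ?_, ?_, ?_⟩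
    · exact (mul_le_mul_right (le_max_left a b) _).trans (ENNReal.inv_mul_cancel h ht).le
    · exact (mul_le_mul_right (le_max_right a b) _).trans (ENNReal.inv_mul_cancel h ht).le
    · rw [mul_assoc, ← max_mul_min a b, ← mul_assoc, ENNReal.inv_mul_cancel h ht, one_mul]

/-! ### Calculus of transport plans. -/

/-- Transport plans between `M` and `N`, without the local finiteness condition. -/
structure IsPlan (M N : Measure Plane) (ρ : Measure (Plane × Plane)) : Prop where
  supported : ρ (closedUpper ×ˢ closedUpper)ᶜ = 0
  fst_marginal : ∀ A : Set Plane, MeasurableSet A → A ⊆ upper → ρ (A ×ˢ closedUpper) = M A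
  snd_marginal : ∀ B : Set Plane, MeasurableSet B → B ⊆ upper → ρ (closedUpper ×ˢ B) = N B

theorem IsAdmissible.isPlan {M N : Measure Plane} {ρ : Measure (Plane × Plane)}
    (h : IsAdmissible M N ρ) : IsPlan M N ρ := ⟨h.supported, h.fst_marginal, h.snd_marginal⟩

/-- Local finiteness of a plan is automatic between measures of finite persistence. -/
theorem IsPlan.isAdmissible {p : ℝ} (hp : 1 ≤ p) {M N : Measure Plane}
    {ρ : Measure (Plane × Plane)} (h : IsPlan M N ρ) (hM : pers p M < ∞) (hN : pers p N < ∞) :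
    IsAdmissible M N ρ := by
  refine ⟨h.supported, fun K hK hKE => ?_, h.fst_marginal, h.snd_marginal⟩
  -- A compact set of pairs not both on the diagonal lies in a single `W n`, and the marginals bound
  -- the mass of `W n` in the closed square by the masses of `layer n`.
  let W : ℕ → Set (Plane × Plane) := fun n => (layer n ×ˢ univ) ∪ (univ ×ˢ layer n)
  have hW : ∀ n, IsOpen (W n) := fun n =>
    ((isOpen_layer n).prod isOpen_univ).union (isOpen_univ.prod (isOpen_layer n))
  have hWmono : Monotone W := fun m n hmn =>
    union_subset_union (prod_mono (monotone_layer hmn) subset_rfl)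
      (prod_mono subset_rfl (monotone_layer hmn))
  have hcover : K ⊆ ⋃ n, W n := by
    rintro ⟨x, y⟩ hxy
    obtain ⟨⟨hx, hy⟩, hd⟩ := hKE hxy
    by_cases hxd : x ∈ upper
    · rw [← iUnion_layer] at hxd
      obtain ⟨n, hn⟩ := mem_iUnion.1 hxd
      exact mem_iUnion.2 ⟨n, Or.inl ⟨hn, trivial⟩⟩
    · have hyu : y ∈ upper := by
        by_contra hyu
        exact hd ⟨hx.resolve_left hxd, hy.resolve_left hyu⟩
      rw [← iUnion_layer] at hyu
      obtain ⟨n, hn⟩ := mem_iUnion.1 hyu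
      exact mem_iUnion.2 ⟨n, Or.inr ⟨trivial, hn⟩⟩
  obtain ⟨n, hn⟩ := hK.elim_directed_cover W hW hcover hWmono.directed_le
  have hsub : K ⊆ (layer n ×ˢ closedUpper) ∪ (closedUpper ×ˢ layer n) := fun z hz => by
    obtain ⟨⟨h1, h2⟩, -⟩ := hKE hz
    rcases hn hz with h' | h'
    · exact Or.inl ⟨h'.1, h2⟩
    · exact Or.inr ⟨h1, h'.2⟩
  refine ((measure_mono hsub).trans (measure_union_le _ _)).trans_lt ?_
  rw [h.fst_marginal _ (isOpen_layer n).measurableSet inter_subset_left,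
    h.snd_marginal _ (isOpen_layer n).measurableSet inter_subset_left]
  exact ENNReal.add_lt_top.2 ⟨measure_layer_lt_top hp hM n, measure_layer_lt_top hp hN n⟩

namespace IsPlan

theorem swap {M N : Measure Plane} {ρ : Measure (Plane × Plane)} (h : IsPlan M N ρ) :
    IsPlan N M (ρ.map Prod.swap) := by
  refine ⟨?_, fun A hA hAu => ?_, fun B hB hBu => ?_⟩
  · rw [Measure.map_apply measurable_swap
      (measurableSet_closedUpper.prod measurableSet_closedUpper).compl, preimage_compl,
      preimage_swap_prod]
    exact h.supported
  · rw [Measure.map_apply measurable_swap (hA.prod measurableSet_closedUpper), preimage_swap_prod]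
    exact h.snd_marginal A hA hAu
  · rw [Measure.map_apply measurable_swap (measurableSet_closedUpper.prod hB), preimage_swap_prod]
    exact h.fst_marginal B hB hBu

theorem smul {M N : Measure Plane} {ρ : Measure (Plane × Plane)} (h : IsPlan M N ρ) (c : ℝ≥0∞) :
    IsPlan (c • M) (c • N) (c • ρ) := by
  refine ⟨?_, fun A hA hAu => ?_, fun B hB hBu => ?_⟩
  · simp [h.supported]
  · simp [h.fst_marginal A hA hAu]
  · simp [h.snd_marginal B hB hBu]

theorem sum {ι : Type*} {M N : ι → Measure Plane} {ρ : ι → Measure (Plane × Plane)}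
    (h : ∀ n, IsPlan (M n) (N n) (ρ n)) :
    IsPlan (Measure.sum M) (Measure.sum N) (Measure.sum ρ) := by
  refine ⟨?_, fun A hA hAu => ?_, fun B hB hBu => ?_⟩
  · rw [Measure.sum_apply _ (measurableSet_closedUpper.prod measurableSet_closedUpper).compl]
    simp [(h _).supported]
  · rw [Measure.sum_apply _ (hA.prod measurableSet_closedUpper), Measure.sum_apply _ hA]
    simp only [(h _).fst_marginal A hA hAu]
  · rw [Measure.sum_apply _ (measurableSet_closedUpper.prod hB), Measure.sum_apply _ hB]
    simp only [(h _).snd_marginal B hB hBu]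

end IsPlan

theorem cost_swap (p : ℝ) (ρ : Measure (Plane × Plane)) : cost p (ρ.map Prod.swap) = cost p ρ := by
  unfold cost
  rw [lintegral_map (measurable_edist_rpow p) measurable_swap]
  simp only [Prod.fst_swap, Prod.snd_swap, edist_comm]

/-- An integral against a plan splits along a partition of the first coordinate. -/
theorem IsPlan.lintegral_eq_tsum_add {M N : Measure Plane} {ρ : Measure (Plane × Plane)}
    (h : IsPlan M N ρ) {θ : ℝ≥0∞} {C : ℕ → Set Plane} {D : ℕ → ℝ≥0∞}
    (hC : IsWhitneyPartition θ C D) (G : Plane × Plane → ℝ≥0∞) :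
    ∫⁻ z, G z ∂ρ =
      ∑' i, ∫⁻ z in C i ×ˢ closedUpper, G z ∂ρ + ∫⁻ z in diag ×ˢ closedUpper, G z ∂ρ := by
  have h1 : ∫⁻ z, G z ∂ρ = ∫⁻ z in closedUpper ×ˢ closedUpper, G z ∂ρ := by
    rw [Measure.restrict_eq_self_of_ae_mem]
    exact h.supported
  have h2 : closedUpper ×ˢ closedUpper =
      (⋃ i, C i ×ˢ closedUpper) ∪ diag ×ˢ closedUpper := by
    rw [← iUnion_prod_const, hC.iUnion_eq, ← union_prod]; rfl
  rw [h1, h2, lintegral_union (measurableSet_diag.prod measurableSet_closedUpper),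
    lintegral_iUnion (fun i => (hC.measurableSet i).prod measurableSet_closedUpper)]
  · intro i j hij
    exact Disjoint.set_prod_left (hC.disjoint hij) _ _
  · rw [← iUnion_prod_const, hC.iUnion_eq]
    refine Disjoint.set_prod_left ?_ _ _
    rw [disjoint_left]
    exact fun x hx hd => notMem_upper_of_mem_diag hd hx

/-! ### The spreading kernel. -/

/-- The kernel that redistributes the first coordinate over its cell `C i` with density `β i`
with respect to `M`, and moves the remaining mass to the diagonal. -/
def spread (M : Measure Plane) (C : ℕ → Set Plane) (β : ℕ → ℝ≥0∞) (z : Plane × Plane) :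
    Measure (Plane × Plane) :=
  Measure.sum (fun i => ((C i).indicator (fun _ => β i) z.1) •
    (M.restrict (C i)).map (fun x => (x, z.2))) +
  (1 - ∑' i, (C i).indicator (fun _ => β i * M (C i)) z.1) • Measure.dirac (diagProj z.1, z.2)

theorem lintegral_spread (M : Measure Plane) (C : ℕ → Set Plane) (β : ℕ → ℝ≥0∞) (z : Plane × Plane)
    {g : Plane × Plane → ℝ≥0∞} (hg : Measurable g) :
    ∫⁻ w, g w ∂(spread M C β z) =
      ∑' i, (C i).indicator (fun _ => β i) z.1 * ∫⁻ x in C i, g (x, z.2) ∂M +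
      (1 - ∑' i, (C i).indicator (fun _ => β i * M (C i)) z.1) * g (diagProj z.1, z.2) := by
  unfold spread
  rw [lintegral_add_measure, lintegral_sum_measure, lintegral_smul_measure, lintegral_dirac' _ hg]
  congr 1
  refine tsum_congr fun i => ?_
  rw [lintegral_smul_measure, lintegral_map hg (by fun_prop), smul_eq_mul]

/-- Finiteness of `M` on the cells makes each restriction s-finite, so that the inner integral is
measurable in the second coordinate. -/
theorem measurable_spread {M : Measure Plane} {C : ℕ → Set Plane} (hC : ∀ i, MeasurableSet (C i))
    (hM : ∀ i, M (C i) < ∞) (β : ℕ → ℝ≥0∞) : Measurable (spread M C β) := by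
  refine Measure.measurable_of_measurable_coe _ fun S hS => ?_
  have hfin : ∀ i, IsFiniteMeasure (M.restrict (C i)) := fun i =>
    ⟨by rw [Measure.restrict_apply_univ]; exact hM i⟩
  have hg : Measurable (S.indicator (1 : Plane × Plane → ℝ≥0∞)) := measurable_one.indicator hS
  have heq : (fun z => spread M C β z S) = fun z =>
      ∑' i, (C i).indicator (fun _ => β i) z.1 * ∫⁻ x in C i, S.indicator 1 (x, z.2) ∂M +
      (1 - ∑' i, (C i).indicator (fun _ => β i * M (C i)) z.1) *
        S.indicator 1 (diagProj z.1, z.2) := funext fun z => by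
    rw [← lintegral_indicator_one hS]
    exact lintegral_spread M C β z hg
  rw [heq]
  refine Measurable.add (Measurable.tsum fun i => Measurable.mul ?_ ?_)
    (Measurable.mul (measurable_const.sub (Measurable.tsum fun i => ?_)) ?_)
  · exact (measurable_const.indicator (hC i)).comp measurable_fst
  · exact (Measurable.lintegral_prod_left' hg).comp measurable_snd
  · exact (measurable_const.indicator (hC i)).comp measurable_fst
  · exact hg.comp ((measurable_diagProj.comp measurable_fst).prodMk measurable_snd)

section Spread

variable {M : Measure Plane} {θ : ℝ≥0∞} {C : ℕ → Set Plane} {D : ℕ → ℝ≥0∞}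

theorem IsWhitneyPartition.tsum_indicator (hC : IsWhitneyPartition θ C D) (a : ℕ → ℝ≥0∞) {i : ℕ}
    {x : Plane} (hx : x ∈ C i) : ∑' j, (C j).indicator (fun _ => a j) x = a i := by
  rw [tsum_eq_single i, indicator_of_mem hx]
  intro j hj
  exact indicator_of_notMem (fun hxj => (disjoint_left.1 (hC.disjoint hj)) hxj hx) _

theorem lintegral_spread_of_mem (hC : IsWhitneyPartition θ C D) (β : ℕ → ℝ≥0∞) {i : ℕ}
    {z : Plane × Plane} (hz : z.1 ∈ C i) {g : Plane × Plane → ℝ≥0∞} (hg : Measurable g) :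
    ∫⁻ w, g w ∂(spread M C β z) =
      β i * ∫⁻ x in C i, g (x, z.2) ∂M + (1 - β i * M (C i)) * g (diagProj z.1, z.2) := by
  rw [lintegral_spread M C β z hg, hC.tsum_indicator _ hz]
  congr 1
  rw [← hC.tsum_indicator (fun j => β j * ∫⁻ x in C j, g (x, z.2) ∂M) hz]
  refine tsum_congr fun j => ?_
  by_cases h : z.1 ∈ C j <;> simp [h]

theorem lintegral_spread_of_mem_diag (hC : IsWhitneyPartition θ C D) (β : ℕ → ℝ≥0∞)
    {z : Plane × Plane} (hz : z.1 ∈ diag) {g : Plane × Plane → ℝ≥0∞} (hg : Measurable g) :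
    ∫⁻ w, g w ∂(spread M C β z) = g z := by
  have h : ∀ i, z.1 ∉ C i := fun i hi => notMem_upper_of_mem_diag hz (hC.subset_upper i hi)
  rw [lintegral_spread M C β z hg]
  simp [h, diagProj_of_mem hz]

end Spread

/-! ### Replacing a marginal of a plan. -/

/-- The discrepancy of the masses that two measures give to the cells, weighted with the distances
of the cells to the diagonal. -/
def discrepancy (p : ℝ) (C : ℕ → Set Plane) (D : ℕ → ℝ≥0∞) (M N : Measure Plane) : ℝ≥0∞ :=
  ∑' i, ((M (C i) - N (C i)) + (N (C i) - M (C i))) * D i ^ p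

/-- The first marginal of a plan can be replaced by a measure with similar cell masses. -/
theorem IsPlan.exists_replace_fst {p : ℝ} (hp : 1 ≤ p) {A B θ : ℝ≥0∞} (hA : 1 ≤ A)
    (hAB : ∀ a b : ℝ≥0∞, (a + b) ^ p ≤ A * a ^ p + B * b ^ p)
    {C : ℕ → Set Plane} {D : ℕ → ℝ≥0∞} (hC : IsWhitneyPartition θ C D)
    {M N N' : Measure Plane} (hM : pers p M < ∞) (hN : pers p N < ∞)
    (hM0 : M upperᶜ = 0)
    {ρ : Measure (Plane × Plane)} (hρ : IsPlan N N' ρ) :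
    ∃ ρ', IsPlan M N' ρ' ∧ cost p ρ' ≤ A * cost p ρ +
      (B * (θ ^ p * (2 ^ p * pers p M)) + (B + 1) * 2 ^ p * discrepancy p C D M N) := by
  have hp0 : 0 < p := by linarith
  have hMC : ∀ i, M (C i) < ∞ := hC.measure_lt_top hp0.le hM
  have hNC : ∀ i, N (C i) < ∞ := hC.measure_lt_top hp0.le hN
  -- Here `β i` is the inverse of the larger of the two cell masses. Spreading the mass `N (C i)`
  -- with this density puts `β i * N (C i)` times `M` on the cell, which never exceeds `M`.
  choose β hβM hβN hβ using fun i => exists_mul_mul_eq_min (hMC i).ne (hNC i).ne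
  have hCu : ∀ i, C i ⊆ upper := hC.subset_upper
  have hspread := measurable_spread (M := M) hC.measurableSet hMC β
  have hclosed : MeasurableSet (closedUpper ×ˢ closedUpper) :=
    measurableSet_closedUpper.prod measurableSet_closedUpper
  have hcell : ∀ i, MeasurableSet (C i ×ˢ closedUpper) := fun i =>
    (hC.measurableSet i).prod measurableSet_closedUpper
  have hρC : ∀ i, ρ (C i ×ˢ closedUpper) = N (C i) := fun i =>
    hρ.fst_marginal _ (hC.measurableSet i) (hCu i)
  have hMsum : ∀ S, MeasurableSet S → ∑' i, M (S ∩ C i) = M S := fun S hS => by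
    rw [← measure_inter_conull (s := S) hM0, ← hC.iUnion_eq, inter_iUnion, measure_iUnion]
    · exact fun i j hij => (hC.disjoint hij).mono inter_subset_right inter_subset_right
    · exact fun i => hS.inter (hC.measurableSet i)
  -- The part of `M` that spreading `N` leaves uncovered; it is matched with the diagonal.
  set R : Measure Plane := Measure.sum fun i => (1 - β i * N (C i)) • M.restrict (C i) with hR
  have hdiagMap : Measurable fun x : Plane => (x, diagProj x) :=
    measurable_id.prodMk measurable_diagProj
  have hRint : ∀ g : Plane × Plane → ℝ≥0∞, Measurable g →
      ∫⁻ w, g w ∂(R.map fun x => (x, diagProj x)) =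
        ∑' i, (1 - β i * N (C i)) * ∫⁻ x in C i, g (x, diagProj x) ∂M := fun g hg => by
    rw [lintegral_map hg hdiagMap, hR, lintegral_sum_measure]
    simp only [lintegral_smul_measure, smul_eq_mul]
  have hbind : ∀ g : Plane × Plane → ℝ≥0∞, Measurable g →
      ∫⁻ w, g w ∂(ρ.bind (spread M C β)) =
        ∑' i, ∫⁻ z in C i ×ˢ closedUpper, (β i * ∫⁻ x in C i, g (x, z.2) ∂M +
          (1 - β i * M (C i)) * g (diagProj z.1, z.2)) ∂ρ +
        ∫⁻ z in diag ×ˢ closedUpper, g z ∂ρ := fun g hg => by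
    rw [Measure.lintegral_bind hspread.aemeasurable hg.aemeasurable, hρ.lintegral_eq_tsum_add hC]
    congr 1
    · refine tsum_congr fun i => setLIntegral_congr_fun (hcell i) fun z hz => ?_
      exact lintegral_spread_of_mem hC β hz.1 hg
    · refine setLIntegral_congr_fun (measurableSet_diag.prod measurableSet_closedUpper)
        fun z hz => ?_
      exact lintegral_spread_of_mem_diag hC β hz.1 hg
  -- Support and both marginals of the new plan are read off from this formula.
  have happly : ∀ S, MeasurableSet S →
      (ρ.bind (spread M C β) + R.map fun x => (x, diagProj x)) S =
      ∑' i, ∫⁻ z in C i ×ˢ closedUpper, (β i * ∫⁻ x in C i, S.indicator 1 (x, z.2) ∂M +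
          (1 - β i * M (C i)) * S.indicator 1 (diagProj z.1, z.2)) ∂ρ +
        ∫⁻ z in diag ×ˢ closedUpper, S.indicator 1 z ∂ρ +
      ∑' i, (1 - β i * N (C i)) * ∫⁻ x in C i, S.indicator 1 (x, diagProj x) ∂M := fun S hS => by
    have hg : Measurable (S.indicator (1 : Plane × Plane → ℝ≥0∞)) := measurable_one.indicator hS
    rw [← lintegral_indicator_one hS, lintegral_add_measure, hbind _ hg, hRint _ hg]
  refine ⟨ρ.bind (spread M C β) + R.map fun x => (x, diagProj x), ⟨?_, ?_, ?_⟩, ?_⟩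
  · rw [happly _ hclosed.compl]
    have h1 : ∀ i, ∫⁻ z in C i ×ˢ closedUpper,
        (β i * ∫⁻ x in C i, ((closedUpper ×ˢ closedUpper)ᶜ).indicator 1 (x, z.2) ∂M +
          (1 - β i * M (C i)) *
            ((closedUpper ×ˢ closedUpper)ᶜ).indicator 1 (diagProj z.1, z.2)) ∂ρ = 0 := fun i => by
      refine (setLIntegral_congr_fun (hcell i) (g := fun _ => 0) fun z hz => ?_).trans (by simp)
      have h2 : ∫⁻ x in C i, ((closedUpper ×ˢ closedUpper)ᶜ).indicator (1 : Plane × Plane → ℝ≥0∞) (x, z.2) ∂M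
          = 0 := by
        refine (setLIntegral_congr_fun (hC.measurableSet i) (g := fun _ => 0)
          fun x hx => ?_).trans (by simp)
        exact indicator_of_notMem (by exact notMem_compl_iff.2 ⟨Or.inl (hCu i hx), hz.2⟩) _
      have h3 : ((closedUpper ×ˢ closedUpper)ᶜ).indicator (1 : Plane × Plane → ℝ≥0∞)
          (diagProj z.1, z.2) = 0 :=
        indicator_of_notMem (by exact notMem_compl_iff.2 ⟨Or.inr (diagProj_mem _), hz.2⟩) _
      simp only [h2, h3, mul_zero, add_zero]
    have h4 : ∫⁻ z in diag ×ˢ closedUpper,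
        ((closedUpper ×ˢ closedUpper)ᶜ).indicator (1 : Plane × Plane → ℝ≥0∞) z ∂ρ = 0 := by
      refine (setLIntegral_congr_fun (measurableSet_diag.prod measurableSet_closedUpper)
        (g := fun _ => 0) fun z hz => ?_).trans (by simp)
      exact indicator_of_notMem (by exact notMem_compl_iff.2 ⟨Or.inr hz.1, hz.2⟩) _
    have h5 : ∀ i, ∫⁻ x in C i, ((closedUpper ×ˢ closedUpper)ᶜ).indicator (1 : Plane × Plane → ℝ≥0∞)
        (x, diagProj x) ∂M = 0 := fun i => by
      refine (setLIntegral_congr_fun (hC.measurableSet i) (g := fun _ => 0)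
        fun x hx => ?_).trans (by simp)
      exact indicator_of_notMem (by exact notMem_compl_iff.2 ⟨Or.inl (hCu i hx), Or.inr (diagProj_mem _)⟩) _
    simp [h1, h4, h5]
  · intro S hS hSu
    rw [happly _ (hS.prod measurableSet_closedUpper)]
    have h0 : ∀ x y : Plane, y ∈ closedUpper → (S ×ˢ closedUpper).indicator (1 : Plane × Plane → ℝ≥0∞) (x, y)
        = S.indicator 1 x := fun x y hy => by
      by_cases hx : x ∈ S <;> simp [indicator, hx, hy]
    have hproj : ∀ x : Plane, x ∈ diag → S.indicator (1 : Plane → ℝ≥0∞) x = 0 := fun x hx =>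
      indicator_of_notMem (fun h => notMem_upper_of_mem_diag hx (hSu h)) _
    have hint : ∀ i, ∫⁻ x in C i, S.indicator (1 : Plane → ℝ≥0∞) x ∂M = M (S ∩ C i) := fun i => by
      rw [lintegral_indicator_one hS, Measure.restrict_apply hS]
    have h1 : ∀ i, ∫⁻ z in C i ×ˢ closedUpper,
        (β i * ∫⁻ x in C i, (S ×ˢ closedUpper).indicator 1 (x, z.2) ∂M +
          (1 - β i * M (C i)) * (S ×ˢ closedUpper).indicator 1 (diagProj z.1, z.2)) ∂ρ =
        β i * N (C i) * M (S ∩ C i) := fun i => by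
      rw [setLIntegral_congr_fun (hcell i) (g := fun _ => β i * M (S ∩ C i)),
        setLIntegral_const, hρC]
      · ring
      · intro z hz
        simp only [h0 _ _ hz.2, hproj _ (diagProj_mem _), hint, mul_zero, add_zero]
    have h4 : ∫⁻ z in diag ×ˢ closedUpper,
        (S ×ˢ closedUpper).indicator (1 : Plane × Plane → ℝ≥0∞) z ∂ρ = 0 := by
      refine (setLIntegral_congr_fun (measurableSet_diag.prod measurableSet_closedUpper)
        (g := fun _ => 0) fun z hz => ?_).trans (by simp)
      exact (h0 z.1 z.2 hz.2).trans (hproj _ hz.1)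
    have h5 : ∀ i, ∫⁻ x in C i, (S ×ˢ closedUpper).indicator (1 : Plane × Plane → ℝ≥0∞)
        (x, diagProj x) ∂M = M (S ∩ C i) := fun i => by
      simp only [h0 _ _ (Or.inr (diagProj_mem _)), hint]
    simp only [h1, h4, h5, add_zero]
    rw [← ENNReal.tsum_add, ← hMsum S hS]
    refine tsum_congr fun i => ?_
    -- The spread fraction `β i * N (C i)` and the uncovered fraction together make up `M` on the
    -- cell.
    rw [← add_mul, add_tsub_cancel_of_le (hβN i), one_mul]
  · intro S hS hSu
    rw [happly _ (measurableSet_closedUpper.prod hS), ← hρ.snd_marginal S hS hSu,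
      ← lintegral_indicator_one (measurableSet_closedUpper.prod hS), hρ.lintegral_eq_tsum_add hC]
    have h0 : ∀ x y : Plane, x ∈ closedUpper → (closedUpper ×ˢ S).indicator (1 : Plane × Plane → ℝ≥0∞) (x, y)
        = S.indicator 1 y := fun x y hx => by
      by_cases hy : y ∈ S <;> simp [indicator, hx, hy]
    have h5 : ∀ i, ∫⁻ x in C i, (closedUpper ×ˢ S).indicator (1 : Plane × Plane → ℝ≥0∞)
        (x, diagProj x) ∂M = 0 := fun i => by
      refine (setLIntegral_congr_fun (hC.measurableSet i) (g := fun _ => 0)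
        fun x hx => ?_).trans (by simp)
      exact indicator_of_notMem
        (fun h => notMem_upper_of_mem_diag (diagProj_mem x) (hSu h.2)) _
    simp only [h5, mul_zero, tsum_zero, add_zero]
    congr 1
    refine tsum_congr fun i => setLIntegral_congr_fun (hcell i) fun z hz => ?_
    have h2 : ∫⁻ x in C i, (closedUpper ×ˢ S).indicator (1 : Plane × Plane → ℝ≥0∞) (x, z.2) ∂M =
        M (C i) * S.indicator 1 z.2 := by
      rw [setLIntegral_congr_fun (hC.measurableSet i) (g := fun _ => S.indicator 1 z.2),
        setLIntegral_const, mul_comm]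
      exact fun x hx => h0 _ _ (Or.inl (hCu i hx))
    have h3 : (closedUpper ×ˢ S).indicator (1 : Plane × Plane → ℝ≥0∞) z = S.indicator 1 z.2 :=
      h0 z.1 z.2 (Or.inl (hCu i hz.1))
    simp only [h2, h3, h0 _ _ (Or.inr (diagProj_mem _))]
    -- The kernel has total mass one on each cell and fixes the second coordinate, so the second
    -- marginal is unchanged.
    rw [← mul_assoc, ← add_mul, add_tsub_cancel_of_le (hβM i), one_mul]
  · have hdist : ∀ i, ∀ x ∈ C i, edist x (diagProj x) ^ p ≤ 2 ^ p * D i ^ p := fun i x hx => by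
      rw [← ENNReal.mul_rpow_of_nonneg _ _ hp0.le]
      exact ENNReal.rpow_le_rpow ((edist_diagProj_le x).trans (hC.distDiag_le i x hx)) hp0.le
    have hmeas := measurable_edist_rpow p
    have hmove : ∀ x x' y : Plane, edist x' y ^ p ≤ A * edist x y ^ p + B * edist x x' ^ p :=
      fun x x' y => by
        refine le_trans (ENNReal.rpow_le_rpow ?_ hp0.le) (hAB _ _)
        rw [add_comm]
        exact (edist_triangle x' x y).trans (by rw [edist_comm x' x])
    -- The masses sent to the diagonal are exactly the truncated differences of the cell masses,
    -- since `β i * M (C i) * N (C i)` is their minimum.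
    have hβM' : ∀ i, M (C i) - N (C i) = (1 - β i * N (C i)) * M (C i) := fun i => by
      rw [ENNReal.sub_mul (fun _ _ => (hMC i).ne), one_mul, mul_right_comm, hβ, tsub_min]
    have hβN' : ∀ i, N (C i) - M (C i) = (1 - β i * M (C i)) * N (C i) := fun i => by
      rw [ENNReal.sub_mul (fun _ _ => (hNC i).ne), one_mul, hβ, min_comm, tsub_min]
    have hcells : ∀ i, ∫⁻ z in C i ×ˢ closedUpper,
        (β i * ∫⁻ x in C i, edist x z.2 ^ p ∂M +
          (1 - β i * M (C i)) * edist (diagProj z.1) z.2 ^ p) ∂ρ ≤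
        A * ∫⁻ z in C i ×ˢ closedUpper, edist z.1 z.2 ^ p ∂ρ +
          (B * (θ ^ p * (M (C i) * D i ^ p)) + B * 2 ^ p * ((N (C i) - M (C i)) * D i ^ p)) :=
      fun i => by
      have hpt : ∀ z ∈ C i ×ˢ closedUpper, β i * ∫⁻ x in C i, edist x z.2 ^ p ∂M +
          (1 - β i * M (C i)) * edist (diagProj z.1) z.2 ^ p ≤ A * edist z.1 z.2 ^ p +
            (β i * M (C i) * (B * (θ ^ p * D i ^ p)) +
              (1 - β i * M (C i)) * (B * (2 ^ p * D i ^ p))) := fun z hz => by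
        have h1 : ∫⁻ x in C i, edist x z.2 ^ p ∂M ≤
            (A * edist z.1 z.2 ^ p + B * (θ ^ p * D i ^ p)) * M (C i) := by
          rw [← setLIntegral_const]
          refine setLIntegral_mono' (hC.measurableSet i) fun x hx => ?_
          refine (hmove z.1 x z.2).trans ?_
          rw [← ENNReal.mul_rpow_of_nonneg _ _ hp0.le]
          gcongr
          exact hC.edist_le i _ hz.1 _ hx
        have h2 : edist (diagProj z.1) z.2 ^ p ≤
            A * edist z.1 z.2 ^ p + B * (2 ^ p * D i ^ p) := by
          refine (hmove z.1 _ z.2).trans ?_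
          gcongr
          exact hdist i _ hz.1
        have h3 : β i * M (C i) + (1 - β i * M (C i)) = 1 := add_tsub_cancel_of_le (hβM i)
        calc _ ≤ β i * ((A * edist z.1 z.2 ^ p + B * (θ ^ p * D i ^ p)) * M (C i)) +
              (1 - β i * M (C i)) * (A * edist z.1 z.2 ^ p + B * (2 ^ p * D i ^ p)) := by gcongr
          _ = (β i * M (C i) + (1 - β i * M (C i))) * (A * edist z.1 z.2 ^ p) +
              (β i * M (C i) * (B * (θ ^ p * D i ^ p)) +
              (1 - β i * M (C i)) * (B * (2 ^ p * D i ^ p))) := by ring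
          _ = _ := by rw [h3, one_mul]
      refine (setLIntegral_mono' (hcell i) hpt).trans ?_
      rw [lintegral_add_left (hmeas.const_mul A), lintegral_const_mul _ hmeas, setLIntegral_const,
        hρC, hβN']
      gcongr
      have h4 : β i * M (C i) * N (C i) ≤ M (C i) := (hβ i).trans_le (min_le_left _ _)
      calc _ = B * (θ ^ p * (β i * M (C i) * N (C i) * D i ^ p)) +
            B * 2 ^ p * ((1 - β i * M (C i)) * N (C i) * D i ^ p) := by ring
        _ ≤ _ := by gcongr
    have hrest : ∀ i, (1 - β i * N (C i)) * ∫⁻ x in C i, edist x (diagProj x) ^ p ∂M ≤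
        2 ^ p * ((M (C i) - N (C i)) * D i ^ p) := fun i => by
      calc _ ≤ (1 - β i * N (C i)) * (2 ^ p * D i ^ p * M (C i)) := by
            gcongr
            rw [← setLIntegral_const]
            exact setLIntegral_mono' (hC.measurableSet i) (hdist i)
        _ = _ := by rw [hβM']; ring
    have hdisc : ∑' i, (M (C i) - N (C i)) * D i ^ p + ∑' i, (N (C i) - M (C i)) * D i ^ p =
        discrepancy p C D M N := by
      unfold discrepancy
      rw [← ENNReal.tsum_add]
      exact tsum_congr fun i => (add_mul _ _ _).symm
    unfold cost
    rw [lintegral_add_measure, hbind _ hmeas, hRint _ hmeas, hρ.lintegral_eq_tsum_add hC]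
    set T₁ := ∑' i, (M (C i) - N (C i)) * D i ^ p
    set T₂ := ∑' i, (N (C i) - M (C i)) * D i ^ p
    calc _ ≤ ∑' i, (A * ∫⁻ z in C i ×ˢ closedUpper, edist z.1 z.2 ^ p ∂ρ +
          (B * (θ ^ p * (M (C i) * D i ^ p)) + B * 2 ^ p * ((N (C i) - M (C i)) * D i ^ p))) +
          A * ∫⁻ z in diag ×ˢ closedUpper, edist z.1 z.2 ^ p ∂ρ +
          ∑' i, 2 ^ p * ((M (C i) - N (C i)) * D i ^ p) := by
          refine add_le_add (add_le_add (ENNReal.tsum_le_tsum hcells) ?_)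
            (ENNReal.tsum_le_tsum hrest)
          exact le_mul_of_one_le_left zero_le hA
      _ = A * (∑' i, ∫⁻ z in C i ×ˢ closedUpper, edist z.1 z.2 ^ p ∂ρ +
            ∫⁻ z in diag ×ˢ closedUpper, edist z.1 z.2 ^ p ∂ρ) +
          (B * (θ ^ p * ∑' i, M (C i) * D i ^ p) + (B * 2 ^ p * T₂ + 2 ^ p * T₁)) := by
          simp only [ENNReal.tsum_add, ENNReal.tsum_mul_left]
          ring
      _ ≤ _ := by
          gcongr
          · exact hC.tsum_le_pers hp0.le M
          · rw [← hdisc]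
            -- The missing cross terms are added so that the bound depends on `T₁ + T₂` only.
            calc B * 2 ^ p * T₂ + 2 ^ p * T₁
                ≤ (B * 2 ^ p * T₂ + 2 ^ p * T₁) + (B * 2 ^ p * T₁ + 2 ^ p * T₂) := le_self_add
              _ = _ := by ring

/-! ### Countable partition of `𝓜^p` by cell masses. -/

theorem exists_nat_mul_le {a δ : ℝ≥0∞} (ha : a ≠ ∞) (hδ : δ ≠ 0) (hδt : δ ≠ ∞) :
    ∃ k : ℕ, k * δ ≤ a ∧ a ≤ k * δ + δ := by
  lift a to NNReal using ha
  lift δ to NNReal using hδt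
  have hδ0 : 0 < δ := pos_iff_ne_zero.2 (by simpa using hδ)
  refine ⟨⌊a / δ⌋₊, ?_, ?_⟩
  · have := Nat.floor_le (zero_le (a := a / δ))
    rw [le_div_iff₀ hδ0] at this
    exact_mod_cast this
  · have := (Nat.lt_floor_add_one (a / δ)).le
    rw [div_le_iff₀ hδ0, add_mul, one_mul] at this
    exact_mod_cast this

/-- A countable `ε`-net from below for the summable nonnegative sequences. -/
theorem exists_countable_net {ε : ℝ≥0∞} (hε : 0 < ε) :
    ∃ s : ℕ → ℕ → ℝ≥0∞, ∀ a : ℕ → ℝ≥0∞, ∑' i, a i ≠ ∞ →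
      ∃ n, (∀ i, s n i ≤ a i) ∧ ∑' i, (a i - s n i) ≤ ε := by
  obtain ⟨δ, hδ0, hδ⟩ := ENNReal.exists_pos_sum_of_countable (ENNReal.half_pos hε.ne').ne' ℕ
  -- The net consists of the finitely supported sequences whose `i`-th entry is a multiple of `δ i`.
  -- Rounding down costs at most `∑ δ i`, and truncating to `F` costs the tail of `a`; each is at
  -- most `ε / 2`.
  obtain ⟨e, he⟩ := exists_surjective_nat (ℕ →₀ ℕ)
  refine ⟨fun n i => e n i * δ i, fun a ha => ?_⟩
  have hai : ∀ i, a i ≠ ∞ := fun i => ne_top_of_le_ne_top ha (ENNReal.le_tsum i)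
  obtain ⟨F, hF⟩ : ∃ F : Finset ℕ, ∑' i : {i // i ∉ F}, a i < ε / 2 :=
    ((ENNReal.tendsto_tsum_compl_atTop_zero ha).eventually_lt_const
      (ENNReal.half_pos hε.ne')).exists
  choose k hk1 hk2 using fun i => exists_nat_mul_le (hai i)
    (ENNReal.coe_ne_zero.2 (hδ0 i).ne') ENNReal.coe_ne_top
  obtain ⟨n, hn⟩ := he (Finsupp.onFinset F (fun i => if i ∈ F then k i else 0) (by simp +contextual))
  have hen : ∀ i, e n i = if i ∈ F then k i else 0 := fun i => by rw [hn]; rfl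
  refine ⟨n, fun i => ?_, ?_⟩
  · by_cases hi : i ∈ F
    · simpa [hen, hi] using hk1 i
    · simp [hen, hi]
  · calc ∑' i, (a i - e n i * δ i) ≤ ∑' i, (δ i + {i | i ∉ F}.indicator a i) := by
          refine ENNReal.tsum_le_tsum fun i => ?_
          by_cases hi : i ∈ F
          · simpa [hen, hi, add_comm] using hk2 i
          · simp [hen, hi]
      _ = ∑' i, (δ i : ℝ≥0∞) + ∑' i : {i // i ∉ F}, a i := by
          rw [ENNReal.tsum_add, ← tsum_subtype]
          rfl
      _ ≤ ε / 2 + ε / 2 := add_le_add hδ.le hF.le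
      _ = ε := ENNReal.add_halves ε

/-- `𝓜^p` is a countable disjoint union of Borel sets on which the cell masses are almost
constant. -/
theorem exists_partition_discrepancy_le {p : ℝ} (hp : 1 ≤ p) {θ : ℝ≥0∞} {C : ℕ → Set Plane}
    {D : ℕ → ℝ≥0∞} (hC : IsWhitneyPartition θ C D) {ε : ℝ≥0∞} (hε : 0 < ε) :
    ∃ T : ℕ → Set (PersMeasure p), (∀ n, MeasurableSet (T n)) ∧
      Pairwise (Function.onFun Disjoint T) ∧ ⋃ n, T n = univ ∧
      ∀ n, ∀ μ ∈ T n, ∀ ν ∈ T n, discrepancy p C D μ.toMeasure ν.toMeasure ≤ ε := by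
  have hp0 : 0 ≤ p := by linarith
  obtain ⟨s, hs⟩ := exists_countable_net (ENNReal.half_pos hε.ne')
  let a : PersMeasure p → ℕ → ℝ≥0∞ := fun μ i => μ.toMeasure (C i) * D i ^ p
  have ha : ∀ i, Measurable fun μ => a μ i := fun i =>
    ((Measure.measurable_coe (hC.measurableSet i)).comp (measurable_toMeasure hp)).mul_const _
  have hat : ∀ μ, ∑' i, a μ i ≠ ∞ := fun μ =>
    ((hC.tsum_le_pers hp0 μ.toMeasure).trans_lt
      (ENNReal.mul_lt_top (ENNReal.rpow_lt_top_of_nonneg hp0 (by simp)) μ.2.2)).ne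
  let U : ℕ → Set (PersMeasure p) := fun n =>
    {μ | ∀ i, s n i ≤ a μ i} ∩ {μ | ∑' i, (a μ i - s n i) ≤ ε / 2}
  have hU : ∀ n, MeasurableSet (U n) := fun n => by
    refine MeasurableSet.inter ?_ (measurableSet_le
      (Measurable.tsum fun i => (ha i).sub_const _) measurable_const)
    rw [ofPred_forall]
    exact MeasurableSet.iInter fun i => measurableSet_le measurable_const (ha i)
  refine ⟨disjointed U, MeasurableSet.disjointed hU, disjoint_disjointed U, ?_, ?_⟩
  · rw [iUnion_disjointed]
    exact eq_univ_of_forall fun μ => mem_iUnion.2 (hs (a μ) (hat μ))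
  · intro n μ hμ ν hν
    obtain ⟨hμ1, hμ2⟩ := disjointed_subset U n hμ
    obtain ⟨hν1, hν2⟩ := disjointed_subset U n hν
    calc discrepancy p C D μ.toMeasure ν.toMeasure
        ≤ ∑' i, ((a μ i - s n i) + (a ν i - s n i)) := by
          refine ENNReal.tsum_le_tsum fun i => ?_
          have hD : D i ^ p ≠ ∞ := ENNReal.rpow_ne_top_of_nonneg hp0 (hC.ne_top i)
          rw [add_mul, ENNReal.sub_mul (fun _ _ => hD), ENNReal.sub_mul (fun _ _ => hD)]
          -- The net lies below both sequences, so replacing the subtracted one by `s n i` only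
          -- increases each truncated difference.
          exact add_le_add (tsub_le_tsub_left (hν1 i) _) (tsub_le_tsub_left (hμ1 i) _)
      _ ≤ ε / 2 + ε / 2 := by
          rw [ENNReal.tsum_add]
          exact add_le_add hμ2 hν2
      _ = ε := ENNReal.add_halves ε

/-! ### Averaging over one piece of the partition. -/

/-- The discrepancy is convex. -/
theorem discrepancy_meanMeasure_le {p : ℝ} (hp : 1 ≤ p) {C : ℕ → Set Plane}
    (hC : ∀ i, MeasurableSet (C i)) (D : ℕ → ℝ≥0∞) (Q : Measure (PersMeasure p)) (ν : Measure Plane) :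
    discrepancy p C D (meanMeasure Q) (Q univ • ν) ≤
      ∫⁻ μ, discrepancy p C D μ.toMeasure ν ∂Q := by
  have hm : ∀ i, Measurable fun μ : PersMeasure p => μ.toMeasure (C i) := fun i =>
    (Measure.measurable_coe (hC i)).comp (measurable_toMeasure hp)
  have hm' : ∀ i, Measurable fun μ : PersMeasure p =>
      (μ.toMeasure (C i) - ν (C i)) + (ν (C i) - μ.toMeasure (C i)) := fun i =>
    ((hm i).sub_const _).add ((hm i).const_sub _)
  unfold discrepancy
  rw [lintegral_tsum fun i => ((hm' i).mul_const _).aemeasurable]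
  refine ENNReal.tsum_le_tsum fun i => ?_
  rw [lintegral_mul_const _ (hm' i), lintegral_add_left ((hm i).sub_const _), meanMeasure_apply hp Q (hC i), Measure.smul_apply,
    smul_eq_mul, mul_comm (Q univ), ← lintegral_const]
  gcongr
  · rw [tsub_le_iff_right, ← lintegral_add_right _ measurable_const]
    exact lintegral_mono fun μ => le_tsub_add
  · rw [tsub_le_iff_right, ← lintegral_add_right _ (hm i)]
    exact lintegral_mono fun μ => le_tsub_add

theorem pers_smul (p : ℝ) (c : ℝ≥0∞) (M : Measure Plane) : pers p (c • M) = c * pers p M := by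
  unfold pers
  rw [Measure.restrict_smul, lintegral_smul_measure, smul_eq_mul]

theorem pers_sum {ι : Type*} (p : ℝ) (M : ι → Measure Plane) :
    pers p (Measure.sum M) = ∑' i, pers p (M i) := by
  unfold pers
  rw [Measure.restrict_sum _ measurableSet_upper, lintegral_sum_measure]

theorem cost_smul (p : ℝ) (c : ℝ≥0∞) (ρ : Measure (Plane × Plane)) :
    cost p (c • ρ) = c * cost p ρ := by
  unfold cost
  rw [lintegral_smul_measure, smul_eq_mul]

theorem cost_sum {ι : Type*} (p : ℝ) (ρ : ι → Measure (Plane × Plane)) :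
    cost p (Measure.sum ρ) = ∑' i, cost p (ρ i) :=
  lintegral_sum_measure _ _

theorem meanMeasure_compl_upper {p : ℝ} (hp : 1 ≤ p) (Q : Measure (PersMeasure p)) :
    meanMeasure Q upperᶜ = 0 := by
  rw [meanMeasure_apply hp _ measurableSet_upper.compl]
  simp [show ∀ μ : PersMeasure p, μ.toMeasure upperᶜ = 0 from fun μ => μ.2.1.supported]

/-- The mean of `f` over the event `S`, unnormalised. -/
abbrev partialMean {p : ℝ} (π : Measure (PersMeasure p × PersMeasure p))
    (f : PersMeasure p × PersMeasure p → PersMeasure p) (S : Set (PersMeasure p × PersMeasure p)) :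
    Measure Plane :=
  meanMeasure ((π.restrict S).map f)

theorem sum_partialMean {p : ℝ} (hp : 1 ≤ p) (π : Measure (PersMeasure p × PersMeasure p))
    {f : PersMeasure p × PersMeasure p → PersMeasure p} (hf : Measurable f) {ι : Type*} [Countable ι]
    {S : ι → Set (PersMeasure p × PersMeasure p)} (hS : ∀ i, MeasurableSet (S i))
    (hd : Pairwise (Function.onFun Disjoint S)) (hu : ⋃ i, S i = univ) :
    Measure.sum (fun i => partialMean π f (S i)) = meanMeasure (π.map f) := by
  ext A hA
  have hm : Measurable fun μ : PersMeasure p => μ.toMeasure A :=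
    (Measure.measurable_coe hA).comp (measurable_toMeasure hp)
  rw [Measure.sum_apply _ hA, meanMeasure_apply hp _ hA, lintegral_map hm hf,
    ← setLIntegral_univ, ← hu, lintegral_iUnion hS hd]
  refine tsum_congr fun i => ?_
  rw [meanMeasure_apply hp _ hA, lintegral_map hm hf]

/-- On an event on which the cell masses of both coordinates are almost constant, the partial means
have a plan which is almost as good as the best plan of a sample. -/
theorem exists_isPlan_partialMean {p : ℝ} (hp : 1 ≤ p) {A B θ ε : ℝ≥0∞} (hA : 1 ≤ A) (hε : 0 < ε)
    (hAB : ∀ a b : ℝ≥0∞, (a + b) ^ p ≤ A * a ^ p + B * b ^ p)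
    {C : ℕ → Set Plane} {D : ℕ → ℝ≥0∞} (hC : IsWhitneyPartition θ C D)
    (π : Measure (PersMeasure p × PersMeasure p)) [IsFiniteMeasure π]
    {T T' : Set (PersMeasure p)} (hT : MeasurableSet T) (hT' : MeasurableSet T')
    (hd : ∀ μ ∈ T, ∀ ν ∈ T, discrepancy p C D μ.toMeasure ν.toMeasure ≤ ε)
    (hd' : ∀ μ ∈ T', ∀ ν ∈ T', discrepancy p C D μ.toMeasure ν.toMeasure ≤ ε)
    (hY : ∫⁻ z in T ×ˢ T', z.1.OT z.2 ^ p ∂π ≠ ∞)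
    (hM : pers p (partialMean π Prod.fst (T ×ˢ T')) < ∞)
    (hM' : pers p (partialMean π Prod.snd (T ×ˢ T')) < ∞) :
    ∃ ρ, IsPlan (partialMean π Prod.fst (T ×ˢ T')) (partialMean π Prod.snd (T ×ˢ T')) ρ ∧
      cost p ρ ≤ A * (A * (∫⁻ z in T ×ˢ T', z.1.OT z.2 ^ p ∂π + ε * π (T ×ˢ T')) +
        (B * (θ ^ p * (2 ^ p * pers p (partialMean π Prod.fst (T ×ˢ T')))) +
          (B + 1) * 2 ^ p * (ε * π (T ×ˢ T')))) +
        (B * (θ ^ p * (2 ^ p * pers p (partialMean π Prod.snd (T ×ˢ T')))) +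
          (B + 1) * 2 ^ p * (ε * π (T ×ˢ T'))) := by
  have hS : MeasurableSet (T ×ˢ T') := hT.prod hT'
  set S := T ×ˢ T'
  rcases eq_or_ne (π S) 0 with h0 | h0
  · have hr : π.restrict S = 0 := Measure.restrict_eq_zero.2 h0
    have hz : ∀ f, partialMean π f S = 0 := fun f => by
      simp [partialMean, meanMeasure, hr]
    refine ⟨0, ?_, by simp [cost]⟩
    rw [hz, hz]
    exact ⟨by simp, by simp, by simp⟩
  have hπS : π S ≠ ∞ := measure_ne_top π S
  -- The constant `c` is a lower bound on `S`, so `c * π S` is at most the integral, and a single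
  -- pair with value below `c + ε` can represent the whole of `S`.
  set c : ℝ≥0∞ := ⨅ z ∈ S, z.1.OT z.2 ^ p
  have hcY : c * π S ≤ ∫⁻ z in S, z.1.OT z.2 ^ p ∂π := by
    rw [← setLIntegral_const]
    exact setLIntegral_mono' hS fun z hz => iInf₂_le z hz
  have hct : c ≠ ∞ := by
    intro h
    rw [h, ENNReal.top_mul h0, top_le_iff] at hcY
    exact hY hcY
  obtain ⟨z, hzS, hz⟩ : ∃ z ∈ S, z.1.OT z.2 ^ p < c + ε := by
    have : ⨅ z ∈ S, z.1.OT z.2 ^ p < c + ε := ENNReal.lt_add_right hct hε.ne'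
    simpa only [iInf_lt_iff, exists_prop] using this
  obtain ⟨ρ₀, hρ₀, hcost⟩ : ∃ ρ₀, IsAdmissible z.1.toMeasure z.2.toMeasure ρ₀ ∧
      cost p ρ₀ < c + ε := by
    unfold PersMeasure.OT at hz
    rw [OTMeasure_rpow hp] at hz
    simpa only [iInf_lt_iff, exists_prop] using hz
  have hpers : ∀ ν : PersMeasure p, pers p (π S • ν.toMeasure) < ∞ := fun ν => by
    rw [pers_smul]
    exact ENNReal.mul_lt_top hπS.lt_top ν.2.2
  have hdisc : ∀ f : PersMeasure p × PersMeasure p → PersMeasure p, Measurable f →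
      ∀ T₀ : Set (PersMeasure p), MeasurableSet T₀ → (∀ w ∈ S, f w ∈ T₀) →
      (∀ μ ∈ T₀, ∀ ν ∈ T₀, discrepancy p C D μ.toMeasure ν.toMeasure ≤ ε) → ∀ ν ∈ T₀,
      discrepancy p C D (partialMean π f S) (π S • ν.toMeasure) ≤ ε * π S := by
    intro f hf T₀ hT₀ hfT hdT ν hν
    have hQ : ((π.restrict S).map f) univ = π S := by
      rw [Measure.map_apply hf MeasurableSet.univ, preimage_univ, Measure.restrict_apply_univ]
    rw [← hQ]
    refine (discrepancy_meanMeasure_le hp hC.measurableSet D _ _).trans ?_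
    rw [← lintegral_const]
    refine lintegral_mono_ae ?_
    have hae : ∀ᵐ μ ∂((π.restrict S).map f), μ ∈ T₀ :=
      (ae_map_iff hf.aemeasurable hT₀).2 ((ae_restrict_mem hS).mono hfT)
    exact hae.mono fun μ hμ => hdT μ hμ ν hν
  -- The first marginal is corrected, then the second one after a swap. Each correction costs one
  -- factor `A`.
  obtain ⟨ρ₁, hρ₁, hcost₁⟩ := (hρ₀.isPlan.smul (π S)).exists_replace_fst hp hA hAB hC hM
    (hpers z.1) (meanMeasure_compl_upper hp _)
  obtain ⟨ρ₂, hρ₂, hcost₂⟩ := hρ₁.swap.exists_replace_fst hp hA hAB hC hM'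
    (hpers z.2) (meanMeasure_compl_upper hp _)
  refine ⟨ρ₂.map Prod.swap, hρ₂.swap, ?_⟩
  rw [cost_swap] at hcost₂ ⊢
  refine hcost₂.trans ?_
  have h1 := hdisc Prod.fst measurable_fst T hT (fun w hw => hw.1) hd z.1 hzS.1
  have h2 := hdisc Prod.snd measurable_snd T' hT' (fun w hw => hw.2) hd' z.2 hzS.2
  have h3 : cost p (π S • ρ₀) ≤ ∫⁻ z in S, z.1.OT z.2 ^ p ∂π + ε * π S := by
    rw [cost_smul]
    calc π S * cost p ρ₀ ≤ π S * (c + ε) := by gcongr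
      _ = c * π S + ε * π S := by ring
      _ ≤ _ := by gcongr
  gcongr
  refine hcost₁.trans ?_
  gcongr

/-! ### Summation over the pieces and passage to the limit. -/

theorem OT_linearExpectation_rpow_le {p : ℝ} (hp : 1 ≤ p) (P P' : Wasserstein p)
    (π : Measure (PersMeasure p × PersMeasure p)) (hπ : IsCoupling P P' π) :
    (linearExpectation hp P).OT (linearExpectation hp P') ^ p ≤ ∫⁻ z, z.1.OT z.2 ^ p ∂π := by
  have hp0 : 0 < p := by linarith
  set Y := ∫⁻ z, z.1.OT z.2 ^ p ∂π
  rcases eq_or_ne Y ∞ with hYt | hYt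
  · rw [hYt]; exact le_top
  have hπ1 : π univ = 1 := by
    have h1 : IsProbabilityMeasure P.law := P.2.1
    rw [← h1.measure_univ, ← hπ.map_fst, Measure.map_apply measurable_fst MeasurableSet.univ,
      preimage_univ]
  have hfin : IsFiniteMeasure π := ⟨by rw [hπ1]; exact ENNReal.one_lt_top⟩
  set E := (linearExpectation hp P).toMeasure
  set E' := (linearExpectation hp P').toMeasure
  have hpE : pers p E < ∞ := (linearExpectation hp P).2.2
  have hpE' : pers p E' < ∞ := (linearExpectation hp P').2.2
  have key : ∀ A B ε : ℝ≥0∞, 1 ≤ A → 0 < ε →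
      (∀ a b : ℝ≥0∞, (a + b) ^ p ≤ A * a ^ p + B * b ^ p) →
      (linearExpectation hp P).OT (linearExpectation hp P') ^ p ≤
        A * A * Y + ε * (A * (A + (B * (2 ^ p * pers p E) + (B + 1) * 2 ^ p)) +
          (B * (2 ^ p * pers p E') + (B + 1) * 2 ^ p)) := by
    intro A B ε hA hε hAB
    -- With this scale `θ ^ p = ε`, so that all error terms become linear in `ε`.
    obtain ⟨C, D, hC⟩ := exists_isWhitneyPartition (θ := ε ^ p⁻¹)
      (ENNReal.rpow_pos_of_nonneg hε (by positivity))
    have hθ : (ε ^ p⁻¹) ^ p = ε := ENNReal.rpow_inv_rpow hp0.ne' ε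
    obtain ⟨T, hT, hTd, hTu, hTε⟩ := exists_partition_discrepancy_le hp hC hε
    let S : ℕ × ℕ → Set (PersMeasure p × PersMeasure p) := fun n => T n.1 ×ˢ T n.2
    have hS : ∀ n, MeasurableSet (S n) := fun n => (hT n.1).prod (hT n.2)
    have hSd : Pairwise (Function.onFun Disjoint S) := by
      rintro ⟨i, j⟩ ⟨i', j'⟩ hne
      by_cases hi : i = i'
      · have hj : j ≠ j' := fun hj => hne (by rw [hi, hj])
        exact Disjoint.set_prod_right (hTd hj) _ _
      · exact Disjoint.set_prod_left (hTd hi) _ _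
    have hSu : ⋃ n, S n = univ := by
      refine eq_univ_of_forall fun z => ?_
      obtain ⟨i, hi⟩ := mem_iUnion.1 (hTu ▸ mem_univ z.1 : z.1 ∈ ⋃ n, T n)
      obtain ⟨j, hj⟩ := mem_iUnion.1 (hTu ▸ mem_univ z.2 : z.2 ∈ ⋃ n, T n)
      exact mem_iUnion.2 ⟨(i, j), hi, hj⟩
    have hsum : Measure.sum (fun n => partialMean π Prod.fst (S n)) = E := by
      rw [sum_partialMean hp π measurable_fst hS hSd hSu, hπ.map_fst]
      rfl
    have hsum' : Measure.sum (fun n => partialMean π Prod.snd (S n)) = E' := by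
      rw [sum_partialMean hp π measurable_snd hS hSd hSu, hπ.map_snd]
      rfl
    have hpsum : ∑' n, pers p (partialMean π Prod.fst (S n)) = pers p E := by
      rw [← pers_sum, hsum]
    have hpsum' : ∑' n, pers p (partialMean π Prod.snd (S n)) = pers p E' := by
      rw [← pers_sum, hsum']
    have hYsum : ∑' n, ∫⁻ z in S n, z.1.OT z.2 ^ p ∂π = Y := by
      rw [← lintegral_iUnion hS hSd, hSu, setLIntegral_univ]
    have hπsum : ∑' n, π (S n) = 1 := by
      rw [← measure_iUnion hSd hS, hSu, hπ1]
    choose ρ hρ hcost using fun n : ℕ × ℕ => exists_isPlan_partialMean hp hA hε hAB hC π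
      (hT n.1) (hT n.2) (hTε n.1) (hTε n.2)
      (ne_top_of_le_ne_top hYt (setLIntegral_le_lintegral _ _))
      (((ENNReal.le_tsum n).trans hpsum.le).trans_lt hpE)
      (((ENNReal.le_tsum n).trans hpsum'.le).trans_lt hpE')
    have hplan : IsPlan E E' (Measure.sum ρ) := by
      rw [← hsum, ← hsum']
      exact IsPlan.sum hρ
    unfold PersMeasure.OT
    rw [OTMeasure_rpow hp]
    refine (iInf₂_le _ (hplan.isAdmissible hp hpE hpE')).trans ?_
    rw [cost_sum]
    refine (ENNReal.tsum_le_tsum hcost).trans ?_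
    simp only [ENNReal.tsum_add, ENNReal.tsum_mul_left]
    change A * (A * (∑' n, ∫⁻ z in S n, z.1.OT z.2 ^ p ∂π + ε * ∑' n, π (S n)) +
      (B * ((ε ^ p⁻¹) ^ p * (2 ^ p * ∑' n, pers p (partialMean π Prod.fst (S n)))) +
        (B + 1) * 2 ^ p * (ε * ∑' n, π (S n)))) +
      (B * ((ε ^ p⁻¹) ^ p * (2 ^ p * ∑' n, pers p (partialMean π Prod.snd (S n)))) +
        (B + 1) * 2 ^ p * (ε * ∑' n, π (S n))) ≤ _
    rw [hYsum, hπsum, hpsum, hpsum', hθ]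
    refine le_of_eq ?_
    ring
  have h2 : (2 : ℝ≥0∞) ^ p ≠ ∞ := ENNReal.rpow_ne_top_of_nonneg hp0.le (by simp)
  -- Since `B` depends on `A`, the limit `ε → 0` is taken first, with `A` and `B` fixed and the
  -- factor `K` of `ε` finite.
  have key' : ∀ A : ℝ≥0∞, 1 < A → A ≠ ∞ →
      (linearExpectation hp P).OT (linearExpectation hp P') ^ p ≤ A * A * Y := by
    intro A hA hAt
    obtain ⟨B, hB, hAB⟩ := exists_add_rpow_le hp0 hA
    set K := A * (A + (B * (2 ^ p * pers p E) + (B + 1) * 2 ^ p)) +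
          (B * (2 ^ p * pers p E') + (B + 1) * 2 ^ p)
    have hKt : K ≠ ∞ := by
      have e1 := hpE.ne
      have e2 := hpE'.ne
      finiteness
    have hlim : Filter.Tendsto (fun ε : ℝ≥0∞ => A * A * Y + ε * K) (nhdsWithin 0 (Ioi 0))
        (nhds (A * A * Y + 0 * K)) :=
      ((ENNReal.continuous_mul_const hKt).const_add _ |>.tendsto 0).mono_left nhdsWithin_le_nhds
    rw [zero_mul, add_zero] at hlim
    refine ge_of_tendsto hlim ?_
    filter_upwards [self_mem_nhdsWithin] with ε hε
    exact key A B ε hA.le hε hAB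
  have hlim : Filter.Tendsto (fun A : ℝ≥0∞ => A * A * Y) (nhdsWithin 1 (Ioi 1))
      (nhds (1 * 1 * Y)) := by
    refine Filter.Tendsto.mono_left ?_ nhdsWithin_le_nhds
    exact ENNReal.Tendsto.mul_const (ENNReal.Tendsto.mul Filter.tendsto_id (by simp)
      Filter.tendsto_id (by simp)) (by simp)
  rw [one_mul, one_mul] at hlim
  have hne : (nhdsWithin (1 : ℝ≥0∞) (Ioi 1)).NeBot := inferInstance
  refine ge_of_tendsto hlim ?_
  filter_upwards [self_mem_nhdsWithin,
    nhdsWithin_le_nhds (isOpen_ne.mem_nhds (ENNReal.one_ne_top))] with A hA hAt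
  exact key' A hA hAt

end Persistence

end

theorem mainTheorem12 (p : ℝ) (hp : 1 ≤ p) (P P' : Persistence.Wasserstein p)
    (π : MeasureTheory.Measure (Persistence.PersMeasure p × Persistence.PersMeasure p))
    (hπ : Persistence.IsCoupling P P' π) :
    (Persistence.linearExpectation hp P).OT (Persistence.linearExpectation hp P') ^ p ≤
      ∫⁻ z, z.1.OT z.2 ^ p ∂π :=
  Persistence.OT_linearExpectation_rpow_le hp P P' π hπ
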